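/- Let $B_6 = O(6)\cap GL(6,\mathbb{Z})$ be the hyperoctahedral group in dimension six, i.e. the group of integral $6\times 6$ matrices $A$ with $AA^T=I_6$. For a subgroup $H$ of $B_6$ let $\mathcal{C}_{B_6}(H)=\{gHg^{-1} : g\in B_6\}$ denote its conjugacy class. Label the vertices of a regular icosahedron by $1,\dots,12$ so that $i$ and $i+6$ (mod $12$) are opposite. Let $\mathcal{I}$ be the icosahedral rotation group, acting faithfully on the vertices and generated by two rotations $g_2,g_3$, which satisfy $g_2^2=g_3^3=(g_2g_3)^5=e$ and act by $$g_2=(1,6)(2,5)(3,9)(4,10)(7,12)(8,11),\qquad g_3=(1,5,6)(2,9,4)(7,11,12)(3,10,8).$$ Let $\hat{\mathcal{I}}:\mathcal{I}\to B_6$ be the representation that sends $g$ to the signed permutation matrix whose $j$-th column is $e_i$ if $g(j)=i$ and $-e_i$ if $g(j)=i+6$ ($1\le i,j\le 6$). Write $\hat{\mathcal{I}}$ also for its image, and let $\mathcal{K}_{\mathcal{G}}=\hat{\mathcal{I}}(\mathcal{G})$ for a subgroup $\mathcal{G}$ of $\mathcal{I}$. A subgroup $\mathcal{H}$ of $B_6$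 is called a crystallographic representation of $\mathcal{I}$ if it is isomorphic to $\mathcal{I}$, the traces of its elements are integers, and its representation on $\mathbb{R}^6$ contains an irreducible subrepresentation of dimension $2$ or $3$. 1. The maximal subgroups of $\mathcal{I}$ are exactly its subgroups that are isomorphic to the tetrahedral group $\mathcal{T}\cong A_4$, to the dihedral group $\mathcal{D}_{10}$ of order $10$, or to the dihedral group $\mathcal{D}_6$ of order $6$. 2. Every element of $\mathcal{C}_{B_6}(\hat{\mathcal{I}})$ is a crystallographic representation of $\mathcal{I}$. 3. Let $\mathcal{G}$ be a maximal subgroup of $\mathcal{I}$. Then for every $P\in\mathcal{C}_{B_6}(\mathcal{K}_{\mathcal{G}})$ there exist exactly two crystallographic representations in $\mathcal{C}_{B_6}(\hat{\mathcal{I}})$ whose intersection is $P$: there are distinct $\mathcal{H}_1,\mathcal{H}_2\in\mathcal{C}_{B_6}(\hat{\mathcal{I}})$ with $P=\mathcal{H}_1\cap\mathcal{H}_2$, and the unordered pair $\{\mathcal{H}_1,\mathcal{H}_2\}$ is the only one (equal members allowed) of elements of $\mathcal{C}_{B_6}(\hat{\mathcal{I}})$ with this property. 4. Consequently, for every $\mathcal{H}\in\mathcal{C}_{B_6}(\hat{\mathcal{I}})$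 and every maximal subgroup $P$ of $\mathcal{H}$ there is exactly one $\mathcal{K}\in\mathcal{C}_{B_6}(\hat{\mathcal{I}})$ with $\mathcal{K}\ne\mathcal{H}$ and $P=\mathcal{H}\cap\mathcal{K}$. -/

import Mathlib

namespace Icosahedral

/-- The hyperoctahedral group `B₆ = O(6) ∩ GL(6, ℤ)`: integral `6 × 6` matrices `A` with
`A * Aᵀ = 1`. -/
abbrev B6 : Type := Matrix.orthogonalGroup (Fin 6) ℤ

/-! The twelve vertices of the regular icosahedron are labelled `1, …, 12` in such a way that the
vertex opposite to `i` is `i + 6` (labels mod 12). Below, the label `i` is the element `i - 1` of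
`Fin 12`. -/

/-- The antipodal map on the vertices. -/
def antipode : Equiv.Perm (Fin 12) := Equiv.addRight 6

/-- The permutations of the vertices that map opposite vertices to opposite vertices. -/
abbrev antipodalPerms : Subgroup (Equiv.Perm (Fin 12)) := Subgroup.centralizer {antipode}

/-- The action of the rotation `g₂` on the vertices: in the labels `1, …, 12`, the permutation
`(1,6)(2,5)(3,9)(4,10)(7,12)(8,11)`. -/
def rot2 : Equiv.Perm (Fin 12) :=
  Equiv.swap 0 5 * Equiv.swap 1 4 * Equiv.swap 2 8 * Equiv.swap 3 9 * Equiv.swap 6 11 *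
    Equiv.swap 7 10

/-- The action of the rotation `g₃` on the vertices: in the labels `1, …, 12`, the permutation
`(1,5,6)(2,9,4)(7,11,12)(3,10,8)`. -/
def rot3 : Equiv.Perm (Fin 12) :=
  List.formPerm [0, 4, 5] * List.formPerm [1, 8, 3] * List.formPerm [6, 10, 11] *
    List.formPerm [2, 9, 7]

/-- The icosahedral group `𝓘`, the rotation group of the regular icosahedron, realised by its
faithful action on the twelve vertices. -/
def ico : Subgroup (Equiv.Perm (Fin 12)) := Subgroup.closure {rot2, rot3}

set_option maxRecDepth 10000 in
/-- The defining relations of the icosahedral group hold. -/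
theorem rot_relations : rot2 ^ 2 = 1 ∧ rot3 ^ 3 = 1 ∧ (rot2 * rot3) ^ 5 = 1 := by
  refine ⟨?_, ?_, ?_⟩ <;> ext x <;> revert x <;> decide

theorem ico_le : ico ≤ antipodalPerms := by
  refine (Subgroup.closure_le _).2 ?_
  rintro x (rfl | rfl) <;> rw [SetLike.mem_coe, Subgroup.mem_centralizer_singleton_iff] <;> decide

/-- The vertex with label `i`, for `1 ≤ i ≤ 6`. -/
def pos (i : Fin 6) : Fin 12 := Fin.castAdd 6 i

/-- The vertex with label `i + 6`, for `1 ≤ i ≤ 6`. -/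
def neg (i : Fin 6) : Fin 12 := Fin.addNat i 6

theorem antipode_pos (i : Fin 6) : antipode (pos i) = neg i := by
  revert i; decide

theorem antipode_neg (i : Fin 6) : antipode (neg i) = pos i := by
  revert i; decide

theorem pos_ne_neg (i j : Fin 6) : pos i ≠ neg j := by
  revert i j; decide

theorem pos_inj {i j : Fin 6} : pos i = pos j ↔ i = j := by
  revert i j; decide

theorem neg_inj {i j : Fin 6} : neg i = neg j ↔ i = j := by
  revert i j; decide

theorem pos_or_neg (v : Fin 12) : (∃ i, v = pos i) ∨ ∃ i, v = neg i := by
  revert v; decide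

/-- The coefficient at `e_i` of the signed basis vector of a vertex `v`, which is `e_k` for the
vertex with label `k` and `-e_k` for the vertex with label `k + 6`, `1 ≤ k ≤ 6`. -/
def coeff (v : Fin 12) (i : Fin 6) : ℤ :=
  if v = pos i then 1 else if v = neg i then -1 else 0

theorem coeff_pos (j i : Fin 6) : coeff (pos j) i = if j = i then 1 else 0 := by
  revert i j; decide

theorem coeff_neg (j i : Fin 6) : coeff (neg j) i = if j = i then -1 else 0 := by
  revert i j; decide

theorem coeff_antipode (v : Fin 12) (i : Fin 6) : coeff (antipode v) i = -coeff v i := by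
  revert v i; decide

/-- The signed permutation matrix of a permutation `p` of the vertices: column `j` is the basis
vector `e_i` if `p j = i`, and `-e_i` if `p j = i + 6`. -/
def signedMatrix (p : Equiv.Perm (Fin 12)) : Matrix (Fin 6) (Fin 6) ℤ :=
  Matrix.of fun i j => coeff (p (pos j)) i

theorem apply_neg {p : Equiv.Perm (Fin 12)} (hp : p ∈ antipodalPerms) (j : Fin 6) :
    p (neg j) = antipode (p (pos j)) := by
  rw [Subgroup.mem_centralizer_singleton_iff] at hp
  have := Equiv.congr_fun hp (pos j)
  simpa [antipode_pos] using this

theorem signedMatrix_one : signedMatrix 1 = 1 := by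
  ext i j
  simp only [signedMatrix, Matrix.of_apply, Equiv.Perm.one_apply, coeff_pos, Matrix.one_apply,
    eq_comm]

theorem signedMatrix_mul {p q : Equiv.Perm (Fin 12)} (hp : p ∈ antipodalPerms) :
    signedMatrix (p * q) = signedMatrix p * signedMatrix q := by
  ext i j
  rw [Matrix.mul_apply]
  simp only [signedMatrix, Matrix.of_apply, Equiv.Perm.mul_apply]
  rcases pos_or_neg (q (pos j)) with ⟨k, hk⟩ | ⟨k, hk⟩
  · simp [hk, coeff_pos]
  · simp [hk, coeff_neg, apply_neg hp, coeff_antipode]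

theorem signedMatrix_transpose {p : Equiv.Perm (Fin 12)} (hp : p ∈ antipodalPerms) :
    (signedMatrix p).transpose = signedMatrix p⁻¹ := by
  ext i j
  have hp' := apply_neg (inv_mem hp)
  have h1 : p (pos i) = pos j ↔ p⁻¹ (pos j) = pos i := by
    rw [Equiv.Perm.inv_eq_iff_eq, eq_comm]
  have h2 : p (pos i) = neg j ↔ p⁻¹ (pos j) = neg i := by
    rw [← Equiv.Perm.eq_inv_iff_eq, hp' j]
    rcases pos_or_neg (p⁻¹ (pos j)) with ⟨l, hl⟩ | ⟨l, hl⟩ <;> rw [hl]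
    · simp [antipode_pos, pos_ne_neg]
    · simp [antipode_neg, pos_inj, neg_inj, eq_comm]
  simp only [signedMatrix, Matrix.transpose_apply, Matrix.of_apply, coeff, h1, h2]

theorem signedMatrix_mem {p : Equiv.Perm (Fin 12)} (hp : p ∈ antipodalPerms) :
    signedMatrix p ∈ Matrix.orthogonalGroup (Fin 6) ℤ := by
  rw [Matrix.mem_orthogonalGroup_iff, signedMatrix_transpose hp, ← signedMatrix_mul hp,
    mul_inv_cancel, signedMatrix_one]

/-- The representation of the icosahedral group in `B₆` by signed permutation matrices. -/
def icoRep : ico →* B6 where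
  toFun g := ⟨signedMatrix g, signedMatrix_mem (ico_le g.2)⟩
  map_one' := Subtype.ext signedMatrix_one
  map_mul' g _ := Subtype.ext (signedMatrix_mul (ico_le g.2))

/-- The images of the two generators under the representation. -/
theorem signedMatrix_generators :
    signedMatrix rot2 =
      !![0, 0, 0, 0, 0, 1;
         0, 0, 0, 0, 1, 0;
         0, 0, -1, 0, 0, 0;
         0, 0, 0, -1, 0, 0;
         0, 1, 0, 0, 0, 0;
         1, 0, 0, 0, 0, 0] ∧
    signedMatrix rot3 =
      !![0, 0, 0, 0, 0, 1;
         0, 0, 0, 1, 0, 0;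
         0, -1, 0, 0, 0, 0;
         0, 0, -1, 0, 0, 0;
         1, 0, 0, 0, 0, 0;
         0, 0, 0, 0, 1, 0] := by
  decide

/-- The subgroup `Î` of `B₆`. -/
def icoHat : Subgroup B6 := icoRep.range

/-- The copy `K_G` in `Î` of a subgroup `G` of the icosahedral group. -/
def copy (G : Subgroup ico) : Subgroup B6 := G.map icoRep

/-- The conjugacy class `{g H g⁻¹ : g ∈ Γ}` of a subgroup `H` of a group `Γ`. -/
def conjClass {Γ : Type*} [Group Γ] (H : Subgroup Γ) : Set (Subgroup Γ) :=
  {K | ∃ g : Γ, K = H.map (MulAut.conj g).toMonoidHom}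

/-- The class `C(Î)`: the conjugacy class of `Î` in `B₆`. -/
def crystReps : Set (Subgroup B6) := conjClass icoHat

/-- The action of an element of `B₆` on the real vector space `ℝ⁶`. -/
def realAction (A : B6) : (Fin 6 → ℝ) →ₗ[ℝ] (Fin 6 → ℝ) :=
  Matrix.toLin' ((A : Matrix (Fin 6) (Fin 6) ℤ).map (Int.cast : ℤ → ℝ))

/-- The subspace `W` of `ℝ⁶` is invariant under the subgroup `H` of `B₆`. -/
def IsInvariant (H : Subgroup B6) (W : Submodule ℝ (Fin 6 → ℝ)) : Prop :=
  ∀ A ∈ H, ∀ w ∈ W, realAction A w ∈ W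

/-- A subgroup `H` of `B₆` is a (six-dimensional, orthogonal) crystallographic representation of
the icosahedral group if it is isomorphic to that group, its characters are integers, and its
representation on `ℝ⁶` contains an irreducible representation of dimension `2` or `3` (in
particular, it is reducible). -/
structure IsCrystallographic (H : Subgroup B6) : Prop where
  iso : Nonempty (H ≃* ico)
  trace_int : ∀ A ∈ H, ∃ m : ℤ, LinearMap.trace ℝ (Fin 6 → ℝ) (realAction A) = m
  exists_irreducible : ∃ W : Submodule ℝ (Fin 6 → ℝ),
    (Module.finrank ℝ W = 2 ∨ Module.finrank ℝ W = 3) ∧ IsInvariant H W ∧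
      ∀ U : Submodule ℝ (Fin 6 → ℝ), U ≤ W → IsInvariant H U → U = ⊥ ∨ U = W

end Icosahedral

open Equiv Pointwise

namespace Icosahedral

/-! ### The maximal subgroups of the alternating group on five letters -/

/-! The rotation group is identified with A₅ by attaching to each vertex the five-cycle of its
rotation by 2π/5; a rotation then moves vertices as its even permutation conjugates five-cycles. For
maximal subgroups of A₅: a proper subgroup of order divisible by 5 lies in a conjugate of D₁₀, and
any other is intransitive on the letters, hence stabilises one or two letters up to conjugation
(`exists_conj_le`).

For the intersections, let C = `conf` be the matrix of inner products of the six axis vectors,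
scaled by √5 and with the diagonal removed. It is a symmetric conference matrix, C² = 5, and Î
commutes with it. Conversely, a signed permutation commuting with C is ± an element of Î, and one
anticommuting with C still normalises Î. Hence gÎg⁻¹ depends only on the pair ±gCgᵀ
(`conj_smul_icoHat_eq`), and if it contains P, then P commutes with gCgᵀ (`commute_confAt`). For
each maximal subgroup, commutation determines a conference matrix up to a few signs, and X² = 5
leaves exactly two pairs ±X. So P lies in exactly two conjugates; being maximal in one of them, it
is their intersection, and all uniqueness claims follow.

Since C² = 5 and C has trace zero, its √5-eigenspace is a three-dimensional invariant subspace. It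
is irreducible: summing over the five rotations about an axis turns any vector of an invariant
subspace with nonzero coordinate on that axis into a multiple of the axial vector, and the axial
vectors span. -/

/-- The alternating group on five letters. -/
abbrev A5 : Type := alternatingGroup (Fin 5)

theorem card_A5 : Nat.card A5 = 60 := by
  rw [nat_card_alternatingGroup, Nat.card_eq_fintype_card, Fintype.card_fin]
  rfl

/-- The index divides 2, and a subgroup of index two would be normal in a simple group. -/
theorem eq_top_of_thirty_dvd {G : Subgroup A5} (h : 30 ∣ Nat.card G) : G = ⊤ := by
  have hmul := G.card_mul_index
  rw [card_A5] at hmul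
  obtain ⟨k, hk⟩ := h
  have hki : k * G.index = 2 := by
    rw [hk] at hmul
    linarith
  have hdvd : G.index ∣ 2 := Dvd.intro_left k hki
  rcases (Nat.dvd_prime Nat.prime_two).1 hdvd with h1 | h2
  · exact Subgroup.index_eq_one.1 h1
  · have hsimple : IsSimpleGroup A5 := alternatingGroup.isSimpleGroup (by simp)
    have hn := Subgroup.normal_of_index_eq_two h2
    rcases hn.eq_bot_or_eq_top with rfl | h
    · rw [Subgroup.index_bot, card_A5] at h2
      omega
    · exact h

/-- A subgroup containing elements of orders two, three and five is the whole group. -/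
theorem eq_top_of_orders {G : Subgroup A5} {x y z : A5} (hx : x ∈ G) (hy : y ∈ G) (hz : z ∈ G)
    (hx' : orderOf x = 2) (hy' : orderOf y = 3) (hz' : orderOf z = 5) : G = ⊤ := by
  have h2 := Subgroup.orderOf_dvd_natCard G hx
  have h3 := Subgroup.orderOf_dvd_natCard G hy
  have h5 := Subgroup.orderOf_dvd_natCard G hz
  rw [hx'] at h2
  rw [hy'] at h3
  rw [hz'] at h5
  apply eq_top_of_thirty_dvd
  omega

/-- The five-cycle `(0 1 2 3 4)`. -/
def fiveCycle : A5 := ⟨finRotate 5, Perm.mem_alternatingGroup.2 (by decide)⟩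

/-- The involution `(1 4)(2 3)`, which inverts the five-cycle `(0 1 2 3 4)`. -/
def flip : A5 := ⟨swap 1 4 * swap 2 3, Perm.mem_alternatingGroup.2 (by decide)⟩

/-- The three-cycle `(0 1 2)`. -/
def threeCycle : A5 := ⟨swap 0 1 * swap 1 2, Perm.mem_alternatingGroup.2 (by decide)⟩

/-- The involution `(0 1)(3 4)`, which inverts the three-cycle `(0 1 2)`. -/
def flip' : A5 := ⟨swap 0 1 * swap 3 4, Perm.mem_alternatingGroup.2 (by decide)⟩

/-- The embedding of the alternating group on four letters as the stabiliser of the last letter. -/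
def tetraHom : alternatingGroup (Fin 4) →* A5 :=
  ((Perm.extendDomainHom (finSuccAboveEquiv (4 : Fin 5))).comp
    (alternatingGroup (Fin 4)).subtype).codRestrict (alternatingGroup (Fin 5)) fun τ =>
      Perm.mem_alternatingGroup.2 ((Perm.sign_extendDomain _ _).trans τ.2)

/-- The embedding of the dihedral group of order ten as the normaliser of a five-cycle. -/
def dihedralFiveHom : DihedralGroup 5 →* A5 where
  toFun
    | .r i => fiveCycle ^ i.val
    | .sr i => flip * fiveCycle ^ i.val
  map_one' := by decide
  map_mul' := by decide

/-- The embedding of the dihedral group of order six as the stabiliser of a pair of letters. -/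
def dihedralThreeHom : DihedralGroup 3 →* A5 where
  toFun
    | .r i => threeCycle ^ i.val
    | .sr i => flip' * threeCycle ^ i.val
  map_one' := by decide
  map_mul' := by decide

theorem tetraHom_injective : Function.Injective tetraHom := by
  intro a b h
  exact Subtype.ext
    (Perm.extendDomainHom_injective (finSuccAboveEquiv (4 : Fin 5)) (congrArg Subtype.val h))

theorem dihedralFiveHom_injective : Function.Injective dihedralFiveHom := by
  rw [injective_iff_map_eq_one]
  decide

theorem dihedralThreeHom_injective : Function.Injective dihedralThreeHom := by
  rw [injective_iff_map_eq_one]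
  decide

/-- The stabiliser of the letter `4`. -/
def tetra : Subgroup A5 := tetraHom.range

/-- The normaliser of the group generated by `(0 1 2 3 4)`. -/
def dihedralFive : Subgroup A5 := dihedralFiveHom.range

/-- The stabiliser of the pair `{3, 4}`. -/
def dihedralThree : Subgroup A5 := dihedralThreeHom.range

/-- The subgroup `tetra` is a copy of the tetrahedral group. -/
noncomputable def tetraEquiv : tetra ≃* alternatingGroup (Fin 4) :=
  (MonoidHom.ofInjective tetraHom_injective).symm

/-- The subgroup `dihedralFive` is a copy of the dihedral group of order ten. -/
noncomputable def dihedralFiveEquiv : dihedralFive ≃* DihedralGroup 5 :=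
  (MonoidHom.ofInjective dihedralFiveHom_injective).symm

/-- The subgroup `dihedralThree` is a copy of the dihedral group of order six. -/
noncomputable def dihedralThreeEquiv : dihedralThree ≃* DihedralGroup 3 :=
  (MonoidHom.ofInjective dihedralThreeHom_injective).symm

theorem card_A4 : Nat.card (alternatingGroup (Fin 4)) = 12 := by
  rw [nat_card_alternatingGroup, Nat.card_eq_fintype_card, Fintype.card_fin]
  rfl

theorem card_tetra : Nat.card tetra = 12 :=
  (Nat.card_congr tetraEquiv.toEquiv).trans card_A4

theorem card_dihedralFive : Nat.card dihedralFive = 10 :=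
  (Nat.card_congr dihedralFiveEquiv.toEquiv).trans DihedralGroup.nat_card

theorem card_dihedralThree : Nat.card dihedralThree = 6 :=
  (Nat.card_congr dihedralThreeEquiv.toEquiv).trans DihedralGroup.nat_card

/-! ### Proper subgroups lie in conjugates of the three models -/

theorem mem_tetra_of_apply {σ : A5} (h : σ.1 4 = 4) : σ ∈ tetra := by
  have key : ∀ σ : A5, σ.1 4 = 4 → ∃ τ : alternatingGroup (Fin 4), ∀ i : Fin 4,
      finSuccAboveEquiv (4 : Fin 5) (τ.1 i) = σ.1 (finSuccAboveEquiv (4 : Fin 5) i) := by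
    decide +kernel
  obtain ⟨τ, hτ⟩ := key σ h
  refine ⟨τ, Subtype.ext (Equiv.ext fun x => ?_)⟩
  by_cases hx : x = 4
  · exact (Perm.extendDomain_apply_not_subtype _ _ (by simp [hx])).trans (hx ▸ h.symm)
  · obtain ⟨i, hi⟩ := (finSuccAboveEquiv (4 : Fin 5)).surjective ⟨x, hx⟩
    obtain rfl : (finSuccAboveEquiv (4 : Fin 5) i : Fin 5) = x := congrArg Subtype.val hi
    exact (Perm.extendDomain_apply_image _ _ i).trans (hτ i)

theorem mem_dihedralThree_of_image {σ : A5} (h : ({3, 4} : Finset (Fin 5)).image σ.1 = {3, 4}) :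
    σ ∈ dihedralThree := by
  have key : ∀ σ : A5, ({3, 4} : Finset (Fin 5)).image σ.1 = {3, 4} →
      ∃ d, dihedralThreeHom d = σ := by decide +kernel
  exact key σ h

/-- Every proper nonempty set of letters can be moved by an even permutation to the last one, two,
three or four letters, up to complements. -/
theorem exists_image_eq (s : Finset (Fin 5)) (h : s ≠ ∅) (h' : s ≠ Finset.univ) :
    ∃ σ : A5, s.image σ.1 = {4} ∨ s.image σ.1 = {4}ᶜ ∨ s.image σ.1 = {3, 4} ∨
      s.image σ.1 = {3, 4}ᶜ := by
  have key : ∀ s : Finset (Fin 5), s ≠ ∅ → s ≠ Finset.univ →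
    ∃ σ : A5, s.image σ.1 = {4} ∨ s.image σ.1 = {4}ᶜ ∨ s.image σ.1 = {3, 4} ∨
      s.image σ.1 = {3, 4}ᶜ := by decide +kernel
  exact key s h h'

/-- The five-cycles split into two classes of A₅, represented by a five-cycle and its square. -/
theorem exists_conj_fiveCycle {x : A5} (h : orderOf x = 5) :
    ∃ σ : A5, σ * x * σ⁻¹ = fiveCycle ∨ σ * x * σ⁻¹ = fiveCycle ^ 2 := by
  have key : ∀ x : A5, x ^ 5 = 1 → x = 1 ∨
      ∃ σ : A5, σ * x * σ⁻¹ = fiveCycle ∨ σ * x * σ⁻¹ = fiveCycle ^ 2 := by decide +kernel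
  refine (key x (orderOf_dvd_iff_pow_eq_one.1 h.dvd)).resolve_left ?_
  rintro rfl
  simp at h

theorem orderOf_fiveCycle : orderOf fiveCycle = 5 := by
  have : Fact (Nat.Prime 5) := ⟨Nat.prime_five⟩
  exact orderOf_eq_prime (by decide) (by decide)

/-- If y is outside D₁₀, its coset under the five-cycle contains elements of orders two and three,
which together with the five-cycle force the whole group. -/
theorem le_dihedralFive {G : Subgroup A5} (hG : G ≠ ⊤) (h : fiveCycle ∈ G) :
    G ≤ dihedralFive := by
  have key : ∀ y : A5, (∃ d, dihedralFiveHom d = y) ∨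
      ((∃ i : Fin 5, (fiveCycle ^ (i : ℕ) * y) ^ 2 = 1 ∧ fiveCycle ^ (i : ℕ) * y ≠ 1) ∧
        ∃ i : Fin 5, (fiveCycle ^ (i : ℕ) * y) ^ 3 = 1 ∧ fiveCycle ^ (i : ℕ) * y ≠ 1) := by
    decide +kernel
  intro y hy
  refine (key y).resolve_right ?_
  rintro ⟨⟨i, hi, hi'⟩, j, hj, hj'⟩
  exact hG (eq_top_of_orders (mul_mem (pow_mem h i) hy) (mul_mem (pow_mem h j) hy) h
    (orderOf_eq_prime hi hi') (orderOf_eq_prime hj hj') orderOf_fiveCycle)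

theorem mem_of_conj_mem_smul {G : Subgroup A5} {σ g : A5} (h : g ∈ MulAut.conj σ • G) :
    σ⁻¹ * g * σ ∈ G := by
  rw [Subgroup.mem_pointwise_smul_iff_inv_smul_mem] at h
  simpa [MulAut.smul_def] using h

/-- A subgroup whose order is prime to five stabilises a set of one or two letters. -/
theorem exists_conj_le_of_not_dvd {G : Subgroup A5} (h : ¬ 5 ∣ Nat.card G) :
    ∃ σ : A5, MulAut.conj σ • G ≤ tetra ∨ MulAut.conj σ • G ≤ dihedralThree := by
  classical
  let s : Finset (Fin 5) := (MulAction.orbit G (0 : Fin 5)).toFinset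
  have hs : ∀ g ∈ G, s.image g.1 = s := by
    intro g hg
    ext x
    simp only [s, Finset.mem_image, Set.mem_toFinset]
    constructor
    · rintro ⟨y, hy, rfl⟩
      exact MulAction.mem_orbit_of_mem_orbit (⟨g, hg⟩ : G) hy
    · intro hx
      refine ⟨g⁻¹.1 x, MulAction.mem_orbit_of_mem_orbit (⟨g, hg⟩⁻¹ : G) hx, ?_⟩
      simp
  have h0 : s ≠ ∅ := Finset.ne_empty_of_mem (a := 0) (by simp [s])
  -- A transitive subgroup would have order divisible by 5, by orbit-stabiliser.
  have h1 : s ≠ Finset.univ := by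
    intro hu
    apply h
    have hc := MulAction.card_orbit_mul_card_stabilizer_eq_card_group G (0 : Fin 5)
    rw [← Set.toFinset_card, show (MulAction.orbit G (0 : Fin 5)).toFinset = Finset.univ from hu,
      Finset.card_univ, Fintype.card_fin, ← Nat.card_eq_fintype_card (α := G)] at hc
    exact Dvd.intro _ hc
  obtain ⟨σ, hσ⟩ := exists_image_eq s h0 h1
  have ht : ∀ g ∈ MulAut.conj σ • G, (s.image σ.1).image g.1 = s.image σ.1 := by
    intro g hg
    have h2 := hs _ (mem_of_conj_mem_smul hg)
    conv_rhs => rw [← h2]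
    simp only [Finset.image_image]
    congr 1
    ext x
    simp
  have hcompl : ∀ (t : Finset (Fin 5)) (g : Perm (Fin 5)), tᶜ.image g = tᶜ → t.image g = t := by
    intro t g htg
    have h5 : tᶜ.image g = (t.image g)ᶜ := by
      ext x
      obtain ⟨y, rfl⟩ := g.surjective x
      simp
    exact compl_injective (h5 ▸ htg)
  refine ⟨σ, ?_⟩
  rcases hσ with h4 | h4 | h4 | h4 <;> rw [h4] at ht
  · exact Or.inl fun g hg => mem_tetra_of_apply (by simpa using ht g hg)
  · exact Or.inl fun g hg => mem_tetra_of_apply (by simpa using hcompl _ _ (ht g hg))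
  · exact Or.inr fun g hg => mem_dihedralThree_of_image (ht g hg)
  · exact Or.inr fun g hg => mem_dihedralThree_of_image (hcompl _ _ (ht g hg))

/-- Every proper subgroup is conjugate to a subgroup of one of the three model subgroups. -/
theorem exists_conj_le {G : Subgroup A5} (hG : G ≠ ⊤) :
    ∃ σ : A5, MulAut.conj σ • G ≤ tetra ∨ MulAut.conj σ • G ≤ dihedralFive ∨
      MulAut.conj σ • G ≤ dihedralThree := by
  by_cases h : 5 ∣ Nat.card G
  · have : Fact (Nat.Prime 5) := ⟨Nat.prime_five⟩
    obtain ⟨x, hx⟩ := exists_prime_orderOf_dvd_card' 5 h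
    obtain ⟨σ, hσ⟩ := exists_conj_fiveCycle ((Subgroup.orderOf_coe x).trans hx)
    have hmem : σ * x * σ⁻¹ ∈ MulAut.conj σ • G :=
      Subgroup.smul_mem_pointwise_smul _ (MulAut.conj σ) G x.2
    refine ⟨σ, Or.inr (Or.inl (le_dihedralFive ?_ ?_))⟩
    · intro htop
      apply hG
      rw [← inv_smul_smul (MulAut.conj σ) G, htop, ← map_inv, Subgroup.Normal.conj_smul_eq_self]
    · rcases hσ with h1 | h1
      · exact h1 ▸ hmem
      -- The square generates the same cyclic group.
      · have h3 : (fiveCycle ^ 2) ^ 3 = fiveCycle := by decide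
        exact h3 ▸ pow_mem (h1 ▸ hmem) 3
  · obtain ⟨σ, h1 | h1⟩ := exists_conj_le_of_not_dvd h
    exacts [⟨σ, Or.inl h1⟩, ⟨σ, Or.inr (Or.inr h1)⟩]

/-! ### Maximality of the three types -/

theorem card_conj_smul {Γ : Type*} [Group Γ] (σ : Γ) (G : Subgroup Γ) :
    Nat.card (MulAut.conj σ • G : Subgroup Γ) = Nat.card G :=
  (Nat.card_congr (Subgroup.equivSMul (MulAut.conj σ) G).toEquiv).symm

theorem card_dvd_of_conj_le {Γ : Type*} [Group Γ] {σ : Γ} {G H : Subgroup Γ}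
    (h : MulAut.conj σ • G ≤ H) : Nat.card G ∣ Nat.card H :=
  card_conj_smul σ G ▸ Subgroup.card_dvd_of_le h

/-- The tetrahedral group has no dihedral subgroup of order six. -/
theorem not_conj_le_tetra {G : Subgroup A5} (e : G ≃* DihedralGroup 3) (σ : A5) :
    ¬ MulAut.conj σ • G ≤ tetra := by
  intro h
  let f : DihedralGroup 3 →* alternatingGroup (Fin 4) :=
    (tetraEquiv.toMonoidHom.comp (Subgroup.inclusion h)).comp
      ((Subgroup.equivSMul (MulAut.conj σ) G).toMonoidHom.comp e.symm.toMonoidHom)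
  have hf : Function.Injective f :=
    (tetraEquiv.injective.comp (Subgroup.inclusion_injective h)).comp
      ((Subgroup.equivSMul (MulAut.conj σ) G).injective.comp e.symm.injective)
  -- The involutions of A₄ all lie in the Klein four-group, whereas two reflections of a triangle do
  -- not commute.
  have key : ∀ a b : alternatingGroup (Fin 4), a * a = 1 → b * b = 1 → a * b = b * a := by
    decide +kernel
  have h1 := key (f (.sr 0)) (f (.sr 1)) (by rw [← map_mul, DihedralGroup.sr_mul_self, map_one])
    (by rw [← map_mul, DihedralGroup.sr_mul_self, map_one])
  rw [← map_mul, ← map_mul] at h1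
  exact absurd (hf h1) (by decide)

theorem isCoatom_of_proper_eq {G : Subgroup A5} (hc : Nat.card G < 60)
    (h : ∀ H : Subgroup A5, H ≠ ⊤ → G ≤ H → Nat.card H ≤ Nat.card G) : IsCoatom G := by
  constructor
  · rintro rfl
    rw [Subgroup.card_top, card_A5] at hc
    omega
  · intro H hGH
    by_contra hH
    have h1 := h H hH hGH.le
    exact hGH.ne (Subgroup.eq_of_le_of_card_ge hGH.le h1)

/-- A proper overgroup is conjugate into a model of order 12, 10 or 6. Comparing orders rules out
any enlargement, except for a group of order 6 inside A₄, which `not_conj_le_tetra` excludes. -/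
theorem isCoatom_of_equiv {G : Subgroup A5}
    (h : Nonempty (G ≃* alternatingGroup (Fin 4)) ∨ Nonempty (G ≃* DihedralGroup 5) ∨
      Nonempty (G ≃* DihedralGroup 3)) : IsCoatom G := by
  have hpos : ∀ H : Subgroup A5, 0 < Nat.card H := fun H => Nat.card_pos
  have hle : ∀ {H : Subgroup A5} {n : ℕ}, 0 < n → Nat.card H ∣ n → Nat.card H ≤ n :=
    fun hn hd => Nat.le_of_dvd hn hd
  rcases h with ⟨⟨e⟩⟩ | ⟨⟨e⟩⟩ | ⟨⟨e⟩⟩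
  · have hG : Nat.card G = 12 := (Nat.card_congr e.toEquiv).trans card_A4
    refine isCoatom_of_proper_eq (by omega) fun H hH hGH => ?_
    obtain ⟨σ, h1 | h1 | h1⟩ := exists_conj_le hH <;> have h2 := card_dvd_of_conj_le h1
    · rw [card_tetra] at h2
      exact hG ▸ hle (by norm_num) h2
    · rw [card_dihedralFive] at h2
      have := hle (by norm_num) h2
      omega
    · rw [card_dihedralThree] at h2
      have := hle (by norm_num) h2
      omega
  · have hG : Nat.card G = 10 := (Nat.card_congr e.toEquiv).trans DihedralGroup.nat_card
    refine isCoatom_of_proper_eq (by omega) fun H hH hGH => ?_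
    have h3 := hG ▸ Subgroup.card_dvd_of_le hGH
    obtain ⟨σ, h1 | h1 | h1⟩ := exists_conj_le hH <;> have h2 := card_dvd_of_conj_le h1
    · rw [card_tetra] at h2
      exact absurd (h3.trans h2) (by norm_num)
    · rw [card_dihedralFive] at h2
      exact hG ▸ hle (by norm_num) h2
    · rw [card_dihedralThree] at h2
      have := hle (by norm_num) h2
      omega
  · have hG : Nat.card G = 6 := (Nat.card_congr e.toEquiv).trans DihedralGroup.nat_card
    refine isCoatom_of_proper_eq (by omega) fun H hH hGH => ?_
    have h3 := hG ▸ Subgroup.card_dvd_of_le hGH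
    obtain ⟨σ, h1 | h1 | h1⟩ := exists_conj_le hH <;> have h2 := card_dvd_of_conj_le h1
    · exact absurd ((Subgroup.pointwise_smul_le_pointwise_smul_iff.2 hGH).trans h1)
        (not_conj_le_tetra e σ)
    · rw [card_dihedralFive] at h2
      exact absurd (h3.trans h2) (by norm_num)
    · rw [card_dihedralThree] at h2
      exact hG ▸ hle (by norm_num) h2

theorem isCoatom_tetra : IsCoatom tetra := isCoatom_of_equiv (.inl ⟨tetraEquiv⟩)

theorem isCoatom_dihedralFive : IsCoatom dihedralFive :=
  isCoatom_of_equiv (.inr (.inl ⟨dihedralFiveEquiv⟩))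

theorem isCoatom_dihedralThree : IsCoatom dihedralThree :=
  isCoatom_of_equiv (.inr (.inr ⟨dihedralThreeEquiv⟩))

/-- The maximal subgroups are the conjugates of the three model subgroups. -/
theorem exists_conj_eq_of_isCoatom {G : Subgroup A5} (hG : IsCoatom G) :
    ∃ σ : A5, ∃ F, (F = tetra ∨ F = dihedralFive ∨ F = dihedralThree) ∧
      G = MulAut.conj σ • F := by
  have key : ∀ (σ : A5) (F : Subgroup A5), F ≠ ⊤ → MulAut.conj σ • G ≤ F →
      G = MulAut.conj σ⁻¹ • F := by
    intro σ F hF h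
    rw [map_inv, eq_inv_smul_iff]
    refine h.eq_of_not_lt fun hlt => ?_
    have h1 : G < (MulAut.conj σ)⁻¹ • F := by
      rw [← Subgroup.pointwise_smul_le_pointwise_smul_iff (a := (MulAut.conj σ)⁻¹),
        inv_smul_smul] at h
      refine lt_of_le_of_ne h fun he => hlt.ne ?_
      rw [he, smul_inv_smul]
    have h2 := hG.2 _ h1
    rw [inv_smul_eq_iff, Subgroup.Normal.conj_smul_eq_self] at h2
    exact hF h2
  obtain ⟨σ, h | h | h⟩ := exists_conj_le hG.1
  · exact ⟨σ⁻¹, _, .inl rfl, key σ _ isCoatom_tetra.1 h⟩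
  · exact ⟨σ⁻¹, _, .inr (.inl rfl), key σ _ isCoatom_dihedralFive.1 h⟩
  · exact ⟨σ⁻¹, _, .inr (.inr rfl), key σ _ isCoatom_dihedralThree.1 h⟩

theorem isCoatom_iff (G : Subgroup A5) :
    IsCoatom G ↔ Nonempty (G ≃* alternatingGroup (Fin 4)) ∨ Nonempty (G ≃* DihedralGroup 5) ∨
      Nonempty (G ≃* DihedralGroup 3) := by
  refine ⟨fun hG => ?_, isCoatom_of_equiv⟩
  obtain ⟨σ, F, hF, rfl⟩ := exists_conj_eq_of_isCoatom hG
  have e := (Subgroup.equivSMul (MulAut.conj σ) F).symm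
  rcases hF with rfl | rfl | rfl
  · exact .inl ⟨e.trans tetraEquiv⟩
  · exact .inr (.inl ⟨e.trans dihedralFiveEquiv⟩)
  · exact .inr (.inr ⟨e.trans dihedralThreeEquiv⟩)

/-! ### The icosahedral group is the alternating group on five letters -/

/-- The rotations by `2π/5` about the vertices with labels `1, …, 6`, as even permutations of five
letters. -/
def axisRotation (i : Fin 6) : A5 :=
  if i = 5 then fiveCycle else
    fiveCycle ^ (i : ℕ) * ⟨List.formPerm [0, 3, 2, 4, 1], Perm.mem_alternatingGroup.2 (by decide)⟩ *
      (fiveCycle ^ (i : ℕ))⁻¹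

/-- The rotations by `2π/5` about the vertices, as even permutations of five letters. -/
def vertexRotation (v : Fin 12) : A5 :=
  Fin.addCases (m := 6) (n := 6) (motive := fun _ => A5) axisRotation
    (fun i => (axisRotation i)⁻¹) v

/-- A vertex can be recovered from its five-cycle, so conjugation of five-cycles determines the
movement of vertices. -/
theorem vertexRotation_injective : Function.Injective vertexRotation := by
  unfold Function.Injective
  decide +kernel

/-- The even permutation `σ` of the letters acts on the vertices by the map `w`. -/
def ActsBy (σ : A5) (w : Fin 12 → Fin 12) : Prop :=
  ∀ v, vertexRotation (w v) = σ * vertexRotation v * σ⁻¹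

instance (σ : A5) (w : Fin 12 → Fin 12) : Decidable (ActsBy σ w) :=
  inferInstanceAs (Decidable (∀ _, _))

theorem ActsBy.eq {σ : A5} {w w' : Fin 12 → Fin 12} (h : ActsBy σ w) (h' : ActsBy σ w') :
    w = w' :=
  funext fun v => vertexRotation_injective ((h v).trans (h' v).symm)

theorem ActsBy.mul {σ τ : A5} {p q : Perm (Fin 12)} (h : ActsBy σ p) (h' : ActsBy τ q) :
    ActsBy (σ * τ) (p * q : Perm (Fin 12)) := by
  intro v
  rw [Perm.mul_apply, h, h']
  group

theorem ActsBy.inv {σ : A5} {p : Perm (Fin 12)} (h : ActsBy σ p) :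
    ActsBy σ⁻¹ (p⁻¹ : Perm (Fin 12)) := by
  intro v
  have h1 := h (p⁻¹ v)
  rw [show p (p⁻¹ v) = v from p.apply_symm_apply v] at h1
  rw [h1]
  group

theorem actsBy_one : ActsBy 1 (1 : Perm (Fin 12)) := fun v => by simp

/-- The even permutation of the letters induced by the rotation `g₂`. -/
def letters2 : A5 := ⟨swap 0 1 * swap 2 3, Perm.mem_alternatingGroup.2 (by decide)⟩

/-- The even permutation of the letters induced by the rotation `g₃`. -/
def letters3 : A5 := ⟨List.formPerm [1, 3, 4], Perm.mem_alternatingGroup.2 (by decide)⟩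

theorem actsBy_rot2 : ActsBy letters2 rot2 := by decide +kernel

theorem actsBy_rot3 : ActsBy letters3 rot3 := by decide +kernel

/-- Only the identity centralises all vertex rotations; this makes the permutation of letters
attached to a rotation unique. -/
theorem eq_one_of_actsBy_one {σ : A5} (h : ActsBy σ (1 : Perm (Fin 12))) : σ = 1 := by
  have key : ∀ σ : A5, ActsBy σ id → σ = 1 := by decide +kernel
  exact key σ h

theorem exists_actsBy (g : ico) : ∃ σ : A5, ActsBy σ g.1 := by
  obtain ⟨g, hg⟩ := g
  induction hg using Subgroup.closure_induction with
  | mem x hx =>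
    rcases hx with rfl | rfl
    exacts [⟨_, actsBy_rot2⟩, ⟨_, actsBy_rot3⟩]
  | one => exact ⟨_, actsBy_one⟩
  | mul x y _ _ h h' =>
    obtain ⟨σ, hσ⟩ := h
    obtain ⟨τ, hτ⟩ := h'
    exact ⟨_, hσ.mul hτ⟩
  | inv x _ h =>
    obtain ⟨σ, hσ⟩ := h
    exact ⟨_, hσ.inv⟩

theorem actsBy_unique {σ τ : A5} {p : Perm (Fin 12)} (h : ActsBy σ p) (h' : ActsBy τ p) :
    σ = τ := by
  have h1 := h'.inv.mul h
  rw [inv_mul_cancel] at h1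
  exact (inv_mul_eq_one.1 (eq_one_of_actsBy_one h1)).symm

/-- The action of the icosahedral group on the five letters. -/
noncomputable def lettersHom : ico →* A5 :=
  MonoidHom.mk' (fun g => (exists_actsBy g).choose) fun g h =>
    actsBy_unique (exists_actsBy (g * h)).choose_spec
      ((exists_actsBy g).choose_spec.mul (exists_actsBy h).choose_spec)

theorem actsBy_lettersHom (g : ico) : ActsBy (lettersHom g) g.1 := (exists_actsBy g).choose_spec

theorem lettersHom_injective : Function.Injective lettersHom := by
  intro g h hgh
  have h1 := actsBy_lettersHom h
  rw [← hgh] at h1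
  exact Subtype.ext (DFunLike.coe_injective ((actsBy_lettersHom g).eq h1))

theorem closure_letters : Subgroup.closure {letters2, letters3} = ⊤ := by
  have h2 : letters2 ∈ Subgroup.closure {letters2, letters3} := Subgroup.subset_closure (.inl rfl)
  have h3 : letters3 ∈ Subgroup.closure {letters2, letters3} := Subgroup.subset_closure (.inr rfl)
  have : Fact (Nat.Prime 5) := ⟨Nat.prime_five⟩
  exact eq_top_of_orders h2 h3 (mul_mem h2 h3) (orderOf_eq_prime (by decide) (by decide))
    (orderOf_eq_prime (by decide) (by decide)) (orderOf_eq_prime (by decide) (by decide))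

theorem lettersHom_surjective : Function.Surjective lettersHom := by
  have h2 : letters2 ∈ lettersHom.range :=
    ⟨⟨rot2, Subgroup.subset_closure (.inl rfl)⟩, actsBy_unique (actsBy_lettersHom _) actsBy_rot2⟩
  have h3 : letters3 ∈ lettersHom.range :=
    ⟨⟨rot3, Subgroup.subset_closure (.inr rfl)⟩, actsBy_unique (actsBy_lettersHom _) actsBy_rot3⟩
  rw [← MonoidHom.range_eq_top, ← top_le_iff, ← closure_letters, Subgroup.closure_le]
  rintro _ (rfl | rfl)
  exacts [h2, h3]

/-- The icosahedral group is isomorphic to the alternating group on five letters. -/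
noncomputable def icoEquiv : ico ≃* A5 :=
  MulEquiv.ofBijective lettersHom ⟨lettersHom_injective, lettersHom_surjective⟩

theorem actsBy_icoEquiv_symm (σ : A5) : ActsBy σ (icoEquiv.symm σ).1 := by
  have h := actsBy_lettersHom (icoEquiv.symm σ)
  rwa [show lettersHom (icoEquiv.symm σ) = σ from icoEquiv.apply_symm_apply σ] at h

theorem isCoatom_map_iff (G : Subgroup ico) :
    IsCoatom (G.map icoEquiv.toMonoidHom) ↔ IsCoatom G :=
  icoEquiv.mapSubgroup.isCoatom_iff G

/-- A subgroup of the icosahedral group and its image in the alternating group. -/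
noncomputable def mapIcoEquiv (G : Subgroup ico) : G ≃* G.map icoEquiv.toMonoidHom :=
  icoEquiv.subgroupMap G

theorem ico_isCoatom_iff (G : Subgroup ico) :
    IsCoatom G ↔ Nonempty (G ≃* alternatingGroup (Fin 4)) ∨ Nonempty (G ≃* DihedralGroup 5) ∨
      Nonempty (G ≃* DihedralGroup 3) := by
  have h : ∀ {K : Type} [Group K],
      Nonempty (G.map icoEquiv.toMonoidHom ≃* K) ↔ Nonempty (G ≃* K) := fun {K} _ =>
    ⟨fun ⟨e⟩ => ⟨(mapIcoEquiv G).trans e⟩, fun ⟨e⟩ => ⟨(mapIcoEquiv G).symm.trans e⟩⟩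
  rw [← isCoatom_map_iff, isCoatom_iff, h, h, h]

/-! ### The six-dimensional representation of the alternating group -/

/-- The representation of the alternating group on five letters in `B₆`. -/
noncomputable def rep : A5 →* B6 := icoRep.comp icoEquiv.symm.toMonoidHom

theorem rep_apply {σ : A5} {w : Fin 12 → Fin 12} (h : ActsBy σ w) :
    (rep σ : Matrix (Fin 6) (Fin 6) ℤ) = Matrix.of fun i j => coeff (w (pos j)) i := by
  obtain rfl := (actsBy_icoEquiv_symm σ).eq h
  rfl

theorem coeff_injective : Function.Injective coeff := by
  intro v w h
  have key : ∀ v w : Fin 12, (∀ i, coeff v i = coeff w i) → v = w := by decide +kernel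
  exact key v w fun i => congrFun h i

theorem icoRep_injective : Function.Injective icoRep := by
  intro g h hgh
  have h1 : ∀ j, g.1 (pos j) = h.1 (pos j) := fun j =>
    coeff_injective (funext fun i => congrFun (congrFun (congrArg Subtype.val hgh) i) j)
  refine Subtype.ext (Equiv.ext fun v => ?_)
  rcases pos_or_neg v with ⟨j, rfl⟩ | ⟨j, rfl⟩
  · exact h1 j
  · rw [apply_neg (ico_le g.2), apply_neg (ico_le h.2), h1]

theorem rep_injective : Function.Injective rep :=
  icoRep_injective.comp icoEquiv.symm.injective

theorem rep_range : rep.range = icoHat := by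
  rw [rep, MonoidHom.range_comp, MonoidHom.range_eq_top.2 icoEquiv.symm.surjective,
    ← MonoidHom.range_eq_map, icoHat]

theorem copy_eq (G : Subgroup ico) : copy G = (G.map icoEquiv.toMonoidHom).map rep := by
  rw [Subgroup.map_map, copy]
  congr 1
  ext1 g
  simp [rep]

theorem smul_map {Γ Δ : Type*} [Group Γ] [Group Δ] (f : Γ →* Δ) (σ : Γ) (G : Subgroup Γ) :
    (MulAut.conj σ • G).map f = MulAut.conj (f σ) • G.map f := by
  change (G.map (MulAut.conj σ).toMonoidHom).map f = (G.map f).map (MulAut.conj (f σ)).toMonoidHom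
  rw [Subgroup.map_map, Subgroup.map_map]
  congr 1
  ext1 g
  simp

/-! ### Signed permutation matrices and the conference matrix of the icosahedron -/

/-- The matrix whose column `j` is the signed basis vector of the vertex `w j`. -/
def vertexMatrix (w : Fin 6 → Fin 12) : Matrix (Fin 6) (Fin 6) ℤ :=
  Matrix.of fun i j => coeff (w j) i

/-- An integer vector of norm one has a single nonzero entry, equal to ±1. -/
theorem exists_coeff_eq {x : Fin 6 → ℤ} (h : ∑ k, x k * x k = 1) : ∃ v, x = coeff v := by
  obtain ⟨k, hk⟩ : ∃ k, x k ≠ 0 := by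
    by_contra! h0
    simp [h0] at h
  have hk1 : 1 ≤ x k * x k := Int.add_one_le_iff.2 (mul_self_pos.2 hk)
  rw [← Finset.add_sum_erase _ _ (Finset.mem_univ k)] at h
  have hnn : ∀ i ∈ Finset.univ.erase k, 0 ≤ x i * x i := fun i _ => mul_self_nonneg _
  have h0 := Finset.sum_nonneg hnn
  have hz := (Finset.sum_eq_zero_iff_of_nonneg hnn).1 (by omega)
  have hz' : ∀ i, k ≠ i → x i = 0 := fun i hi =>
    mul_self_eq_zero.1 (hz i (Finset.mem_erase.2 ⟨hi.symm, Finset.mem_univ i⟩))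
  rcases mul_self_eq_one_iff.1 (show x k * x k = 1 by omega) with h1 | h1
  · refine ⟨pos k, funext fun i => ?_⟩
    rw [coeff_pos]
    split_ifs with hi
    exacts [hi ▸ h1, hz' i hi]
  · refine ⟨neg k, funext fun i => ?_⟩
    rw [coeff_neg]
    split_ifs with hi
    exacts [hi ▸ h1, hz' i hi]

theorem transpose_mul_self (u : B6) : u.1.transpose * u.1 = 1 :=
  (Matrix.mem_orthogonalGroup_iff' _ _).1 u.2

theorem mul_transpose_self (u : B6) : u.1 * u.1.transpose = 1 :=
  (Matrix.mem_orthogonalGroup_iff _ _).1 u.2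

/-- The elements of `B₆` are signed permutation matrices. -/
theorem exists_eq_vertexMatrix (u : B6) : ∃ w, u.1 = vertexMatrix w := by
  have h : ∀ j, ∃ v, (fun k => u.1 k j) = coeff v := fun j => by
    apply exists_coeff_eq
    have := congrFun (congrFun (transpose_mul_self u) j) j
    simpa [Matrix.mul_apply] using this
  choose w hw using h
  exact ⟨w, Matrix.ext fun i j => congrFun (hw j) i⟩

/-- The symmetric conference matrix of the icosahedron: the off-diagonal entry at `(i, j)` is `1` if
the vertices with labels `i` and `j` are adjacent, and `-1` otherwise. -/
def conf : Matrix (Fin 6) (Fin 6) ℤ :=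
  !![0, 1, -1, -1, 1, 1;
     1, 0, 1, -1, -1, 1;
     -1, 1, 0, 1, -1, 1;
     -1, -1, 1, 0, 1, 1;
     1, -1, -1, 1, 0, 1;
     1, 1, 1, 1, 1, 0]

/-- The bilinear form of a matrix at the signed basis vectors of two vertices. -/
def form (X : Matrix (Fin 6) (Fin 6) ℤ) (a b : Fin 12) : ℤ :=
  ∑ l, (∑ k, coeff a k * X k l) * coeff b l

theorem transpose_mul_mul (X : Matrix (Fin 6) (Fin 6) ℤ) (w : Fin 6 → Fin 12) (i j : Fin 6) :
    ((vertexMatrix w).transpose * X * vertexMatrix w) i j = form X (w i) (w j) := by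
  simp [Matrix.mul_apply, vertexMatrix, form]

/-- Up to the factor √5, `form conf` is the inner product of vertices on different axes, and it
vanishes on a common axis. Its invariance need only be checked on the generators. -/
theorem form_conf_apply {g : Perm (Fin 12)} (hg : g ∈ ico) (a b : Fin 12) :
    form conf (g a) (g b) = form conf a b := by
  induction hg using Subgroup.closure_induction generalizing a b with
  | mem x hx =>
    revert a b
    rcases hx with rfl | rfl <;> decide +kernel
  | one => rfl
  | mul x y _ _ h h' => rw [Perm.mul_apply, Perm.mul_apply, h, h']
  | inv x _ h =>
    rw [← h, show x (x⁻¹ a) = a from x.apply_symm_apply a,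
      show x (x⁻¹ b) = b from x.apply_symm_apply b]

theorem form_conf_pos (i j : Fin 6) : form conf (pos i) (pos j) = conf i j := by
  have key : Matrix.of (fun i j => form conf (pos i) (pos j)) = conf := by decide +kernel
  exact congrFun (congrFun key i) j

theorem commute_iff_transpose (u : B6) (X : Matrix (Fin 6) (Fin 6) ℤ) :
    Commute u.1 X ↔ u.1.transpose * X * u.1 = X := by
  constructor
  · intro h
    rw [mul_assoc, ← h.eq, ← mul_assoc, transpose_mul_self, one_mul]
  · intro h
    change u.1 * X = X * u.1
    conv_lhs => rw [← h]
    rw [← mul_assoc, ← mul_assoc, mul_transpose_self, one_mul]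

theorem commute_conf {u : B6} (hu : u ∈ icoHat) : Commute u.1 conf := by
  obtain ⟨g, rfl⟩ := hu
  rw [commute_iff_transpose]
  ext i j
  rw [← form_conf_pos i j, ← form_conf_apply g.2]
  exact transpose_mul_mul conf (fun j => g.1 (pos j)) i j

/-! ### Signed permutations preserving the conference matrix up to sign -/

theorem exists_ico_of_actsBy {σ : A5} {w : Fin 12 → Fin 12} (h : ActsBy σ w) :
    ∃ g ∈ ico, (g : Fin 12 → Fin 12) = w :=
  ⟨_, (icoEquiv.symm σ).2, (actsBy_icoEquiv_symm σ).eq h⟩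

theorem exists_ico_apply_eq (a : Fin 12) : ∃ g ∈ ico, g (pos 5) = a := by
  have key : ∀ a, ∃ σ : A5, vertexRotation a = σ * vertexRotation (pos 5) * σ⁻¹ := by
    decide +kernel
  obtain ⟨σ, hσ⟩ := key a
  exact ⟨_, (icoEquiv.symm σ).2,
    vertexRotation_injective ((actsBy_icoEquiv_symm σ (pos 5)).trans hσ.symm)⟩

/-- The product `rot2 * rot3` is a five-fold rotation about `pos 5`, cyclically permuting its five
neighbours. -/
theorem exists_ico_apply_eq_of_form {a : Fin 12} (h : form conf (pos 5) a = 1) :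
    ∃ g ∈ ico, g (pos 5) = pos 5 ∧ g (pos 0) = a := by
  have key : ∀ a, form conf (pos 5) a = 1 → ∃ i : Fin 5,
      ((rot2 * rot3) ^ (i : ℕ)) (pos 5) = pos 5 ∧ ((rot2 * rot3) ^ (i : ℕ)) (pos 0) = a := by
    decide +kernel
  obtain ⟨i, hi⟩ := key a h
  exact ⟨_, pow_mem (mul_mem (Subgroup.subset_closure (.inl rfl))
    (Subgroup.subset_closure (.inr rfl))) _, hi⟩

/-- A frame of vertices with the same inner products as the standard one is obtained from it by a
rotation or by a rotation followed by the antipodal map. -/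
theorem exists_ico_of_form {w : Fin 6 → Fin 12} (h : ∀ i j, form conf (w i) (w j) = conf i j) :
    ∃ g ∈ ico, (∀ j, w j = g (pos j)) ∨ ∀ j, w j = antipode (g (pos j)) := by
  obtain ⟨g, hg, hg5⟩ := exists_ico_apply_eq (w 5)
  have h' : ∀ i j, form conf (g⁻¹ (w i)) (g⁻¹ (w j)) = conf i j := fun i j => by
    rw [form_conf_apply (inv_mem hg), h]
  have h5 : g⁻¹ (w 5) = pos 5 := by rw [← hg5]; exact g.symm_apply_apply _
  obtain ⟨r, hr, hr5, hr0⟩ := exists_ico_apply_eq_of_form (a := g⁻¹ (w 0))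
    (by rw [← h5, h']; rfl)
  obtain ⟨x, hx⟩ : ∃ x : Fin 6 → Fin 12, ∀ j, w j = g (r (x j)) :=
    ⟨fun j => r⁻¹ (g⁻¹ (w j)), fun j => by
      rw [show r (r⁻¹ _) = _ from r.apply_symm_apply _,
        show g (g⁻¹ _) = _ from g.apply_symm_apply _]⟩
  have hx' : ∀ i j, form conf (x i) (x j) = conf i j := fun i j => by
    rw [← h, hx, hx, form_conf_apply hg, form_conf_apply hr]
  have hx5 : x 5 = pos 5 := by
    rw [hx, hr5.symm, show g⁻¹ (g _) = _ from g.symm_apply_apply _] at h5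
    exact r.injective h5
  have hx0 : x 0 = pos 0 := by
    rw [hx, show g⁻¹ (g _) = _ from g.symm_apply_apply _] at hr0
    exact (r.injective hr0).symm
  -- Two adjacent vertices have two common neighbours. Choosing one as the image of `pos 1` fixes
  -- the frame: one choice gives the identity, the other the reflection `![0, 4, 3, 2, 1, 5]`.
  have key1 : ∀ a, form conf (pos 5) a = 1 → form conf (pos 0) a = 1 → a = pos 1 ∨ a = pos 4 := by
    decide +kernel
  have key2 : ∀ j a, form conf (pos 5) a = conf 5 j → form conf (pos 0) a = conf 0 j →
      form conf (pos 1) a = conf 1 j → a = pos j := by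
    decide +kernel
  have key3 : ∀ j a, form conf (pos 5) a = conf 5 j → form conf (pos 0) a = conf 0 j →
      form conf (pos 4) a = conf 1 j → a = ![0, 4, 3, 2, 1, 5] j := by
    decide +kernel
  have hx1 : x 1 = pos 1 ∨ x 1 = pos 4 :=
    key1 _ (by rw [← hx5, hx']; rfl) (by rw [← hx0, hx']; rfl)
  rcases hx1 with hx1 | hx1
  · refine ⟨g * r, mul_mem hg hr, .inl fun j => ?_⟩
    rw [hx, key2 j (x j) (by rw [← hx5, hx']) (by rw [← hx0, hx']) (by rw [← hx1, hx'])]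
    rfl
  -- The half-turn `s` followed by the antipodal map is the reflection.
  · obtain ⟨s, hs, hs'⟩ := exists_ico_of_actsBy
      (σ := ⟨swap 0 3 * swap 1 2, Perm.mem_alternatingGroup.2 (by decide)⟩)
      (w := ![6, 10, 9, 8, 7, 11, 0, 4, 3, 2, 1, 5]) (by decide +kernel)
    refine ⟨g * (r * s), mul_mem hg (mul_mem hr hs), .inr fun j => ?_⟩
    rw [hx, key3 j (x j) (by rw [← hx5, hx']) (by rw [← hx0, hx']) (by rw [← hx1, hx'])]
    have hanti : ∀ {p : Perm (Fin 12)}, p ∈ ico → ∀ v, antipode (p v) = p (antipode v) :=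
      fun hp v => (Equiv.congr_fun (Subgroup.mem_centralizer_singleton_iff.1 (ico_le hp)) v).symm
    simp only [Perm.mul_apply]
    rw [hanti hg, hanti hr, hs']
    congr 2
    revert j
    decide

theorem conj_neg (u : B6) : MulAut.conj (-u) = MulAut.conj u := by
  ext1 x
  simp [MulAut.conj_apply]

/-- The columns of `u` form a frame with the standard inner products, so `u` is plus or minus an
element of Î, and the sign is central. -/
theorem conj_smul_icoHat_of_commute {u : B6} (h : Commute u.1 conf) :
    MulAut.conj u • icoHat = icoHat := by
  obtain ⟨w, hw⟩ := exists_eq_vertexMatrix u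
  have hf : ∀ i j, form conf (w i) (w j) = conf i j := fun i j => by
    rw [← transpose_mul_mul, ← hw, (commute_iff_transpose u conf).1 h]
  obtain ⟨g, hg, h1 | h1⟩ := exists_ico_of_form hf
  · apply Subgroup.conj_smul_eq_self_of_mem
    refine ⟨⟨g, hg⟩, Subtype.ext ?_⟩
    rw [hw]
    ext i j
    simp [icoRep, signedMatrix, vertexMatrix, h1]
  · obtain rfl : u = -icoRep ⟨g, hg⟩ := by
      refine Subtype.ext ?_
      rw [hw]
      ext i j
      rw [Unitary.coe_neg]
      simp [icoRep, signedMatrix, vertexMatrix, h1, coeff_antipode]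
    rw [conj_neg]
    exact Subgroup.conj_smul_eq_self_of_mem ⟨_, rfl⟩

/-- The signed permutation matrix exchanging the two icosahedra with the same rotation group. -/
def exchange : B6 :=
  ⟨vertexMatrix ![6, 8, 10, 7, 9, 5], (Matrix.mem_orthogonalGroup_iff _ _).2 (by decide +kernel)⟩

theorem exchange_mul_conf : exchange.1 * conf = -(conf * exchange.1) := by
  decide +kernel

instance : Finite icoHat := rep_range ▸ Set.finite_range rep

theorem conj_rep_of_mul_eq {u : B6} {σ τ : A5} {w x : Fin 12 → Fin 12} (hσ : ActsBy σ w)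
    (hτ : ActsBy τ x)
    (h : u.1 * vertexMatrix (w ∘ pos) = vertexMatrix (x ∘ pos) * u.1) :
    MulAut.conj u • rep σ = rep τ := by
  have h1 : u * rep σ = rep τ * u := by
    refine Subtype.ext ?_
    change u.1 * (rep σ).1 = (rep τ).1 * u.1
    rw [rep_apply hσ, rep_apply hτ]
    exact h
  rw [MulAut.smul_def, MulAut.conj_apply, h1, mul_inv_cancel_right]

/-- The conjugated generators are the images of explicit even permutations; the orders then give
equality. -/
theorem conj_smul_icoHat_exchange : MulAut.conj exchange • icoHat = icoHat := by
  have hle : MulAut.conj exchange • icoHat ≤ icoHat := by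
    conv_lhs => rw [← rep_range, MonoidHom.range_eq_map, ← closure_letters, MonoidHom.map_closure]
    rw [Subgroup.smul_closure, Subgroup.closure_le, ← rep_range]
    rintro _ ⟨_, ⟨_, rfl | rfl, rfl⟩, rfl⟩
    · refine ⟨⟨swap 0 2 * swap 1 3, Perm.mem_alternatingGroup.2 (by decide)⟩, Eq.symm ?_⟩
      exact conj_rep_of_mul_eq (x := ![11, 7, 3, 2, 10, 6, 5, 1, 9, 8, 4, 0]) actsBy_rot2
        (by decide +kernel) (by decide +kernel)
    · refine ⟨⟨List.formPerm [2, 4, 3], Perm.mem_alternatingGroup.2 (by decide)⟩, Eq.symm ?_⟩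
      exact conj_rep_of_mul_eq (x := ![3, 2, 10, 11, 7, 6, 9, 8, 4, 5, 1, 0]) actsBy_rot3
        (by decide +kernel) (by decide +kernel)
  exact Subgroup.eq_of_le_of_card_ge hle (card_conj_smul _ _).ge

theorem conj_smul_icoHat_of_anticommute {u : B6} (h : u.1 * conf = -(conf * u.1)) :
    MulAut.conj u • icoHat = icoHat := by
  have h1 : Commute (u * exchange).1 conf := by
    change u.1 * exchange.1 * conf = conf * (u.1 * exchange.1)
    rw [mul_assoc, exchange_mul_conf, mul_neg, ← mul_assoc, h, neg_mul, neg_neg, mul_assoc]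
  have h2 := conj_smul_icoHat_of_commute h1
  rwa [map_mul, mul_smul, conj_smul_icoHat_exchange] at h2

/-! ### The conjugates of `Î` containing a given group -/

/-- The conference matrix attached to the conjugate of `Î` by `g`. -/
def confAt (g : B6) : Matrix (Fin 6) (Fin 6) ℤ := g.1 * conf * g.1.transpose

theorem confAt_one : confAt 1 = conf := by
  simp [confAt]

theorem confAt_mul (g : B6) : confAt g * g.1 = g.1 * conf := by
  rw [confAt, mul_assoc, transpose_mul_self, mul_one]

theorem transpose_mul_confAt (g : B6) : g.1.transpose * confAt g = conf * g.1.transpose := by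
  rw [confAt, ← mul_assoc, ← mul_assoc, transpose_mul_self, one_mul]

/-- The element h⁻¹g commutes or anticommutes with `conf`, hence normalises Î. Counting conjugates
thus reduces to counting conference matrices up to sign. -/
theorem conj_smul_icoHat_eq {g h : B6} (hgh : confAt g = confAt h ∨ confAt g = -confAt h) :
    MulAut.conj g • icoHat = MulAut.conj h • icoHat := by
  rw [← inv_smul_eq_iff, ← map_inv, ← mul_smul, ← map_mul]
  have h1 : (h⁻¹ * g).1 * conf = h.1.transpose * confAt g * g.1 := by
    rw [mul_assoc, confAt_mul, ← mul_assoc]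
    rfl
  rcases hgh with h2 | h2
  · apply conj_smul_icoHat_of_commute
    change (h⁻¹ * g).1 * conf = conf * (h⁻¹ * g).1
    rw [h1, h2, transpose_mul_confAt, mul_assoc]
    rfl
  · apply conj_smul_icoHat_of_anticommute
    rw [h1, h2, mul_neg, transpose_mul_confAt, neg_mul, mul_assoc]
    rfl

theorem commute_confAt {g p : B6} (hp : p ∈ MulAut.conj g • icoHat) :
    Commute p.1 (confAt g) := by
  rw [Subgroup.mem_pointwise_smul_iff_inv_smul_mem, ← map_inv, MulAut.smul_def,
    MulAut.conj_apply, inv_inv] at hp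
  have h1 : g.1.transpose * p.1 * g.1 * conf = conf * (g.1.transpose * p.1 * g.1) :=
    (commute_conf hp).eq
  change p.1 * (g.1 * conf * g.1.transpose) = g.1 * conf * g.1.transpose * p.1
  calc p.1 * (g.1 * conf * g.1.transpose)
      = g.1 * g.1.transpose * p.1 * (g.1 * conf * g.1.transpose) := by
        rw [mul_transpose_self, one_mul]
    _ = g.1 * (g.1.transpose * p.1 * g.1 * conf) * g.1.transpose := by simp only [mul_assoc]
    _ = g.1 * conf * g.1.transpose * p.1 * (g.1 * g.1.transpose) := by
        rw [h1]
        simp only [mul_assoc]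
    _ = g.1 * conf * g.1.transpose * p.1 := by rw [mul_transpose_self, mul_one]

/-- Symmetric conference matrices of order six. -/
structure IsConference (X : Matrix (Fin 6) (Fin 6) ℤ) : Prop where
  symm : ∀ i j, X j i = X i j
  diag : ∀ i, X i i = 0
  offDiag : ∀ i j, i ≠ j → X i j = 1 ∨ X i j = -1
  sq : X * X = 5

theorem isConference_confAt (g : B6) : IsConference (confAt g) := by
  obtain ⟨w, hw⟩ := exists_eq_vertexMatrix g⁻¹
  have hgt : g.1.transpose = vertexMatrix w := hw
  have hg : g.1 = (vertexMatrix w).transpose := by rw [← hgt, Matrix.transpose_transpose]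
  have hform : ∀ i j, confAt g i j = form conf (w i) (w j) := fun i j => by
    rw [← transpose_mul_mul, confAt, hgt, hg]
  have key1 : ∀ a b, form conf b a = form conf a b := by decide +kernel
  have key2 : ∀ a, form conf a a = 0 := by decide +kernel
  -- Distinct rows of `g` are orthogonal, so the corresponding vertices lie on different axes.
  have key3 : ∀ a b, ∑ k, coeff a k * coeff b k = 0 →
      form conf a b = 1 ∨ form conf a b = -1 := by decide +kernel
  refine ⟨fun i j => ?_, fun i => ?_, fun i j hij => ?_, ?_⟩
  · rw [hform, hform, key1]
  · rw [hform, key2]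
  · rw [hform]
    apply key3
    have h1 := congrFun (congrFun (mul_transpose_self g) i) j
    rw [hg, Matrix.one_apply_ne hij, Matrix.mul_apply] at h1
    exact h1
  · have h5 : conf * conf = 5 := by decide +kernel
    rw [confAt, mul_assoc, ← confAt, transpose_mul_confAt, ← mul_assoc, mul_assoc g.1, h5]
    change g.1 * ((5 : ℕ) : Matrix (Fin 6) (Fin 6) ℤ) * g.1.transpose = ((5 : ℕ) : Matrix _ _ ℤ)
    rw [← (Nat.cast_commute 5 g.1).eq, mul_assoc, mul_transpose_self, mul_one]

/-- The axis through a vertex. -/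
def axis (v : Fin 12) : Fin 6 := Fin.addCases (m := 6) (n := 6) (motive := fun _ => Fin 6) id id v

/-- The sign of the signed basis vector of a vertex. -/
def sgn (v : Fin 12) : ℤ := if v < 6 then 1 else -1

theorem coeff_eq (v : Fin 12) (k : Fin 6) : coeff v k = if axis v = k then sgn v else 0 := by
  have key : ∀ v k, coeff v k = if axis v = k then sgn v else 0 := by decide +kernel
  exact key v k

theorem form_eq (X : Matrix (Fin 6) (Fin 6) ℤ) (a b : Fin 12) :
    form X a b = sgn a * sgn b * X (axis a) (axis b) := by
  simp only [form, coeff_eq, ite_mul, zero_mul, mul_ite, mul_zero, Finset.sum_ite_eq,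
    Finset.mem_univ, if_true]
  ring

/-- The entries of a matrix that commutes with a signed permutation matrix. -/
theorem apply_eq_of_commute {σ : A5} {w : Fin 12 → Fin 12} (hσ : ActsBy σ w)
    {X : Matrix (Fin 6) (Fin 6) ℤ} (h : Commute (rep σ).1 X) (i j : Fin 6) :
    X i j = sgn (w (pos i)) * sgn (w (pos j)) * X (axis (w (pos i))) (axis (w (pos j))) := by
  have h1 := (commute_iff_transpose _ _).1 h
  rw [rep_apply hσ] at h1
  rw [← form_eq]
  conv_lhs => rw [← h1]
  exact transpose_mul_mul X (fun j => w (pos j)) i j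

/-- The group `P` lies in exactly two conjugates of `Î`, in one of them as a maximal subgroup. -/
def LiesInTwo (P : Subgroup B6) : Prop :=
  ∃ H₁ ∈ crystReps, ∃ H₂ ∈ crystReps, H₁ ≠ H₂ ∧ P ⋖ H₁ ∧
    ∀ K ∈ crystReps, P ≤ K ↔ K = H₁ ∨ K = H₂

/-- Subgroups of Î are exactly images of subgroups of A₅, so the order embedding has order-convex
image and preserves covering. -/
theorem map_rep_covBy_iff (F : Subgroup A5) : F.map rep ⋖ icoHat ↔ IsCoatom F := by
  rw [← covBy_top_iff, ← rep_range, MonoidHom.range_eq_map]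
  let f : Subgroup A5 ↪o Subgroup B6 :=
    OrderEmbedding.ofMapLEIff (Subgroup.map rep) fun _ _ =>
      Subgroup.map_le_map_iff_of_injective rep_injective
  refine Set.OrdConnected.apply_covBy_apply_iff f ⟨?_⟩
  rintro _ ⟨x, rfl⟩ _ ⟨y, rfl⟩ z ⟨-, hz⟩
  exact ⟨z.comap rep, Subgroup.map_comap_eq_self (hz.trans (Subgroup.map_le_range rep y))⟩

/-- The second conjugate is by an element `c` centralising the image of `F`. The witness `s` shows
that it differs from Î, and `hX` excludes a third. -/
theorem liesInTwo_map {F : Subgroup A5} (hF : IsCoatom F) {a b s : A5}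
    (hab : F = Subgroup.closure {a, b}) {c : B6} (hca : Commute c (rep a))
    (hcb : Commute c (rep b)) (hs : ¬ Commute (c * rep s * c⁻¹).1 conf)
    (hX : ∀ X, IsConference X → Commute (rep a).1 X → Commute (rep b).1 X →
      (X = conf ∨ X = -conf) ∨ X = confAt c ∨ X = -confAt c) : LiesInTwo (F.map rep) := by
  have hcov := (map_rep_covBy_iff F).2 hF
  have hle2 : F.map rep ≤ MulAut.conj c • icoHat := by
    rw [hab, MonoidHom.map_closure, Subgroup.closure_le]
    rintro _ ⟨x, hx, rfl⟩
    have h1 : Commute c (rep x) := by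
      rcases hx with rfl | rfl
      exacts [hca, hcb]
    refine ⟨rep x, rep_range ▸ ⟨x, rfl⟩, ?_⟩
    change c * rep x * c⁻¹ = rep x
    rw [h1.eq, mul_inv_cancel_right]
  refine ⟨icoHat, ⟨1, ?_⟩, MulAut.conj c • icoHat, ⟨c, rfl⟩, fun heq => ?_, hcov, ?_⟩
  · change icoHat = MulAut.conj (1 : B6) • icoHat
    simp
  · apply hs
    apply commute_conf
    rw [heq]
    exact Subgroup.smul_mem_pointwise_smul _ _ _ (rep_range ▸ ⟨s, rfl⟩)
  · rintro _ ⟨g, rfl⟩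
    constructor
    · intro h
      have hmem : ∀ x ∈ F, Commute (rep x).1 (confAt g) := fun x hx =>
        commute_confAt (h ⟨x, hx, rfl⟩)
      have ha : a ∈ F := hab ▸ Subgroup.subset_closure (.inl rfl)
      have hb : b ∈ F := hab ▸ Subgroup.subset_closure (.inr rfl)
      refine (hX _ (isConference_confAt g) (hmem a ha) (hmem b hb)).imp (fun h1 => ?_)
        conj_smul_icoHat_eq
      rw [← confAt_one] at h1
      refine (conj_smul_icoHat_eq h1).trans ?_
      simp
    · rintro (h | h) <;> rw [h]
      exacts [hcov.le, hle2]

theorem LiesInTwo.conj_smul {P : Subgroup B6} (h : LiesInTwo P) (g : B6) :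
    LiesInTwo (MulAut.conj g • P) := by
  have hmem : ∀ {K}, K ∈ crystReps → ∀ u : B6, MulAut.conj u • K ∈ crystReps := by
    rintro _ ⟨v, rfl⟩ u
    refine ⟨u * v, ?_⟩
    change MulAut.conj u • MulAut.conj v • icoHat = MulAut.conj (u * v) • icoHat
    rw [map_mul, mul_smul]
  obtain ⟨H₁, h₁, H₂, h₂, hne, hcov, hiff⟩ := h
  refine ⟨_, hmem h₁ g, _, hmem h₂ g, (MulAction.injective (MulAut.conj g)).ne hne,
    (apply_covBy_apply_iff (MulAut.conj g).mapSubgroup).2 hcov, fun K hK => ?_⟩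
  have h3 := hiff _ (hmem hK g⁻¹)
  rwa [map_inv, ← Subgroup.pointwise_smul_le_pointwise_smul_iff (a := MulAut.conj g),
    smul_inv_smul, inv_smul_eq_iff, inv_smul_eq_iff] at h3

/-! ### From containment to intersection -/

theorem card_of_mem_crystReps {H : Subgroup B6} (h : H ∈ crystReps) :
    Nat.card H = Nat.card icoHat := by
  obtain ⟨g, rfl⟩ := h
  exact card_conj_smul g icoHat

theorem eq_of_le_of_mem_crystReps {H K : Subgroup B6} (hH : H ∈ crystReps) (hK : K ∈ crystReps)
    (h : H ≤ K) : H = K := by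
  have : Finite K := Nat.finite_of_card_ne_zero (card_of_mem_crystReps hK ▸ Nat.card_pos.ne')
  exact Subgroup.eq_of_le_of_card_ge h
    ((card_of_mem_crystReps hK).trans (card_of_mem_crystReps hH).symm).le

theorem eq_inf_of_covBy {P H K : Subgroup B6} (hH : H ∈ crystReps) (hK : K ∈ crystReps)
    (hP : P ⋖ H) (hPK : P ≤ K) (hne : K ≠ H) : P = H ⊓ K := by
  refine (hP.eq_or_eq (le_inf hP.le hPK) inf_le_left).elim Eq.symm fun h => ?_
  exact absurd (eq_of_le_of_mem_crystReps hH hK (inf_eq_left.1 h)).symm hne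

/-! ### The model subgroups lie in exactly two conjugates of `Î` -/

/-- A conference matrix is determined by the entries above the diagonal. -/
theorem IsConference.eq_matrix {X : Matrix (Fin 6) (Fin 6) ℤ} (h : IsConference X) :
    X = !![0, X 0 1, X 0 2, X 0 3, X 0 4, X 0 5;
      X 0 1, 0, X 1 2, X 1 3, X 1 4, X 1 5;
      X 0 2, X 1 2, 0, X 2 3, X 2 4, X 2 5;
      X 0 3, X 1 3, X 2 3, 0, X 3 4, X 3 5;
      X 0 4, X 1 4, X 2 4, X 3 4, 0, X 4 5;
      X 0 5, X 1 5, X 2 5, X 3 5, X 4 5, 0] := by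
  ext i j
  fin_cases i <;> fin_cases j <;> first | exact h.diag _ | rfl | exact h.symm _ _

theorem IsConference.symm_apply {X : Matrix (Fin 6) (Fin 6) ℤ} (h : IsConference X) :
    X 1 0 = X 0 1 ∧ X 2 0 = X 0 2 ∧ X 3 0 = X 0 3 ∧ X 4 0 = X 0 4 ∧ X 5 0 = X 0 5 ∧
      X 2 1 = X 1 2 ∧ X 3 1 = X 1 3 ∧ X 4 1 = X 1 4 ∧ X 5 1 = X 1 5 ∧ X 3 2 = X 2 3 ∧
      X 4 2 = X 2 4 ∧ X 5 2 = X 2 5 ∧ X 4 3 = X 3 4 ∧ X 5 3 = X 3 5 ∧ X 5 4 = X 4 5 := by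
  and_intros <;> exact h.symm _ _

/-- The signed permutation matrix fixing two conjugates of `Î` that meet in `tetra`. -/
def swapTetra : B6 :=
  ⟨vertexMatrix ![5, 10, 3, 2, 7, 0], (Matrix.mem_orthogonalGroup_iff _ _).2 (by decide +kernel)⟩

/-- The signed permutation matrix exchanging two conjugates of `Î` that meet in `dihedralFive`. -/
def swapDihedralFive : B6 :=
  ⟨vertexMatrix ![0, 1, 2, 3, 4, 11], (Matrix.mem_orthogonalGroup_iff _ _).2 (by decide +kernel)⟩

/-- The signed permutation matrix exchanging two conjugates of `Î` that meet in
`dihedralThree`. -/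
def swapDihedralThree : B6 :=
  ⟨vertexMatrix ![0, 7, 2, 9, 4, 11], (Matrix.mem_orthogonalGroup_iff _ _).2 (by decide +kernel)⟩

/-- The three-cycle `(1 2 3)`. -/
def threeCycle' : A5 := ⟨swap 1 2 * swap 2 3, Perm.mem_alternatingGroup.2 (by decide)⟩

theorem actsBy_fiveCycle : ActsBy fiveCycle ![1, 2, 3, 4, 0, 5, 7, 8, 9, 10, 6, 11] := by
  decide +kernel

theorem actsBy_flip : ActsBy flip ![8, 7, 6, 10, 9, 11, 2, 1, 0, 4, 3, 5] := by
  decide +kernel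

theorem actsBy_threeCycle : ActsBy threeCycle ![4, 3, 6, 11, 8, 7, 10, 9, 0, 5, 2, 1] := by
  decide +kernel

theorem actsBy_threeCycle' : ActsBy threeCycle' ![9, 0, 4, 7, 11, 8, 3, 6, 10, 1, 5, 2] := by
  decide +kernel

theorem actsBy_flip' : ActsBy flip' ![6, 7, 4, 5, 2, 3, 0, 1, 10, 11, 8, 9] := by
  decide +kernel

theorem commute_rep {u : B6} {σ : A5} {w : Fin 12 → Fin 12} (hσ : ActsBy σ w)
    (h : u.1 * vertexMatrix (w ∘ pos) = vertexMatrix (w ∘ pos) * u.1) : Commute u (rep σ) := by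
  refine Subtype.ext ?_
  change u.1 * (rep σ).1 = (rep σ).1 * u.1
  rw [rep_apply hσ]
  exact h

theorem not_commute_conj {u : B6} {σ : A5} {w : Fin 12 → Fin 12} (hσ : ActsBy σ w)
    (h : u.1 * vertexMatrix (w ∘ pos) * u.1.transpose * conf ≠
      conf * (u.1 * vertexMatrix (w ∘ pos) * u.1.transpose)) :
    ¬ Commute (u * rep σ * u⁻¹).1 conf := by
  intro hc
  apply h
  have h1 : u.1 * (rep σ).1 * u.1.transpose * conf =
    conf * (u.1 * (rep σ).1 * u.1.transpose) := hc
  rw [rep_apply hσ] at h1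
  exact h1

theorem tetra_eq_closure : tetra = Subgroup.closure {threeCycle, threeCycle'} := by
  have h : ∀ σ : A5, σ.1 4 = 4 → ∃ i j k : Fin 3,
      σ = threeCycle ^ (i : ℕ) * threeCycle' ^ (j : ℕ) * threeCycle ^ (k : ℕ) := by
    decide +kernel
  refine le_antisymm ?_ ((Subgroup.closure_le _).2 ?_)
  · rintro _ ⟨τ, rfl⟩
    obtain ⟨i, j, k, hijk⟩ := h (tetraHom τ) (Perm.extendDomain_apply_not_subtype _ _ (by simp))
    rw [hijk]
    have h1 : threeCycle ∈ Subgroup.closure {threeCycle, threeCycle'} :=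
      Subgroup.subset_closure (.inl rfl)
    exact mul_mem (mul_mem (pow_mem h1 _) (pow_mem (Subgroup.subset_closure (.inr rfl)) _))
      (pow_mem h1 _)
  · rintro _ (rfl | rfl) <;> exact mem_tetra_of_apply (by decide)

theorem dihedralFive_eq_closure : dihedralFive = Subgroup.closure {fiveCycle, flip} := by
  have h1 : fiveCycle ∈ Subgroup.closure {fiveCycle, flip} := Subgroup.subset_closure (.inl rfl)
  have h2 : flip ∈ Subgroup.closure {fiveCycle, flip} := Subgroup.subset_closure (.inr rfl)
  refine le_antisymm ?_ ((Subgroup.closure_le _).2 ?_)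
  · rintro _ ⟨i | i, rfl⟩
    exacts [pow_mem h1 _, mul_mem h2 (pow_mem h1 _)]
  · rintro _ (rfl | rfl)
    exacts [⟨.r 1, by decide⟩, ⟨.sr 0, by decide⟩]

theorem dihedralThree_eq_closure : dihedralThree = Subgroup.closure {threeCycle, flip'} := by
  have h1 : threeCycle ∈ Subgroup.closure {threeCycle, flip'} := Subgroup.subset_closure (.inl rfl)
  have h2 : flip' ∈ Subgroup.closure {threeCycle, flip'} := Subgroup.subset_closure (.inr rfl)
  refine le_antisymm ?_ ((Subgroup.closure_le _).2 ?_)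
  · rintro _ ⟨i | i, rfl⟩
    exacts [pow_mem h1 _, mul_mem h2 (pow_mem h1 _)]
  · rintro _ (rfl | rfl)
    exacts [⟨.r 1, by decide⟩, ⟨.sr 0, by decide⟩]

/-! ### Conference matrices commuting with each model -/

theorem conf_or_of_commute_tetra {X : Matrix (Fin 6) (Fin 6) ℤ} (hX : IsConference X)
    (ha : Commute (rep threeCycle).1 X) (hb : Commute (rep threeCycle').1 X) :
    (X = conf ∨ X = -conf) ∨ X = confAt swapTetra ∨ X = -confAt swapTetra := by
  have ea := apply_eq_of_commute actsBy_threeCycle ha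
  have eb := apply_eq_of_commute actsBy_threeCycle' hb
  -- Signs and axes in `apply_eq_of_commute` are evaluated definitionally, giving linear relations.
  -- They leave two free signs, hence four matrices, which are the two pairs ±X.
  have ha' : X 0 1 = 1 * X 4 3 ∧ X 0 2 = -1 * X 4 0 ∧ X 0 3 = -1 * X 4 5 ∧
      X 0 4 = -1 * X 4 2 ∧ X 0 5 = -1 * X 4 1 ∧ X 1 2 = -1 * X 3 0 ∧ X 1 3 = -1 * X 3 5 ∧
      X 1 4 = -1 * X 3 2 ∧ X 1 5 = -1 * X 3 1 ∧ X 2 5 = 1 * X 0 1 :=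
    ⟨ea 0 1, ea 0 2, ea 0 3, ea 0 4, ea 0 5, ea 1 2, ea 1 3, ea 1 4, ea 1 5, ea 2 5⟩
  have hb' : X 0 1 = -1 * X 3 0 ∧ X 0 2 = -1 * X 3 4 ∧ X 0 3 = 1 * X 3 1 :=
    ⟨eb 0 1, eb 0 2, eb 0 3⟩
  have hs := hX.symm_apply
  have hr : X 0 2 = -X 0 1 ∧ X 0 3 = -X 0 1 ∧ X 0 4 = X 0 1 ∧ X 1 2 = X 0 1 ∧
      X 1 3 = -X 0 1 ∧ X 1 4 = -X 0 5 ∧ X 1 5 = X 0 1 ∧ X 2 3 = X 0 5 ∧ X 2 4 = -X 0 1 ∧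
      X 2 5 = X 0 1 ∧ X 3 4 = X 0 1 ∧ X 3 5 = X 0 1 ∧ X 4 5 = X 0 1 := by
    omega
  clear ea ha' hs eb hb'
  have hm := hX.eq_matrix
  simp only [hr] at hm
  have h01 := hX.offDiag 0 1 (by decide)
  have h05 := hX.offDiag 0 5 (by decide)
  have hsq := hX.sq
  rcases h01 with h01 | h01 <;>
    rcases h05 with h05 | h05 <;>
  · simp only [h01, h05] at hm
    rw [hm] at hsq ⊢
    revert hsq
    decide +kernel

theorem liesInTwo_tetra : LiesInTwo (tetra.map rep) :=
  liesInTwo_map isCoatom_tetra tetra_eq_closure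
    (commute_rep actsBy_threeCycle (by decide +kernel))
    (commute_rep actsBy_threeCycle' (by decide +kernel))
    -- The three-cycle `letters3` lies outside each of the three models, so it can serve as `s`
    -- every time.
    (not_commute_conj actsBy_rot3 (by decide +kernel))
    fun _ hX ha hb => conf_or_of_commute_tetra hX ha hb

theorem conf_or_of_commute_dihedralFive {X : Matrix (Fin 6) (Fin 6) ℤ} (hX : IsConference X)
    (ha : Commute (rep fiveCycle).1 X) :
    (X = conf ∨ X = -conf) ∨ X = confAt swapDihedralFive ∨ X = -confAt swapDihedralFive := by
  have ea := apply_eq_of_commute actsBy_fiveCycle ha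
  have ha' : X 0 1 = 1 * X 1 2 ∧ X 0 2 = 1 * X 1 3 ∧ X 0 3 = 1 * X 1 4 ∧
      X 0 4 = 1 * X 1 0 ∧ X 0 5 = 1 * X 1 5 ∧ X 1 2 = 1 * X 2 3 ∧ X 1 3 = 1 * X 2 4 ∧
      X 1 4 = 1 * X 2 0 ∧ X 1 5 = 1 * X 2 5 ∧ X 2 3 = 1 * X 3 4 ∧ X 2 5 = 1 * X 3 5 ∧
      X 3 5 = 1 * X 4 5 :=
    ⟨ea 0 1, ea 0 2, ea 0 3, ea 0 4, ea 0 5, ea 1 2, ea 1 3, ea 1 4, ea 1 5, ea 2 3, ea 2 5,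
      ea 3 5⟩
  have hs := hX.symm_apply
  -- The five-cycle makes X circulant on the first five axes and constant along the sixth. Of the
  -- three remaining signs, orthogonality of the rows forces X 0 2 = -X 0 1.
  have hr : X 0 3 = X 0 2 ∧ X 0 4 = X 0 1 ∧ X 1 2 = X 0 1 ∧ X 1 3 = X 0 2 ∧
      X 1 4 = X 0 2 ∧ X 1 5 = X 0 5 ∧ X 2 3 = X 0 1 ∧ X 2 4 = X 0 2 ∧ X 2 5 = X 0 5 ∧
      X 3 4 = X 0 1 ∧ X 3 5 = X 0 5 ∧ X 4 5 = X 0 5 := by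
    omega
  clear ea ha' hs
  have hm := hX.eq_matrix
  simp only [hr] at hm
  have h01 := hX.offDiag 0 1 (by decide)
  have h02 := hX.offDiag 0 2 (by decide)
  have h05 := hX.offDiag 0 5 (by decide)
  have hsq := hX.sq
  rcases h01 with h01 | h01 <;>
    rcases h02 with h02 | h02 <;>
    rcases h05 with h05 | h05 <;>
  · simp only [h01, h02, h05] at hm
    rw [hm] at hsq ⊢
    revert hsq
    decide +kernel

theorem liesInTwo_dihedralFive : LiesInTwo (dihedralFive.map rep) :=
  liesInTwo_map isCoatom_dihedralFive dihedralFive_eq_closure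
    (commute_rep actsBy_fiveCycle (by decide +kernel))
    (commute_rep actsBy_flip (by decide +kernel))
    (not_commute_conj actsBy_rot3 (by decide +kernel))
    fun _ hX ha _ => conf_or_of_commute_dihedralFive hX ha

theorem conf_or_of_commute_dihedralThree {X : Matrix (Fin 6) (Fin 6) ℤ} (hX : IsConference X)
    (ha : Commute (rep threeCycle).1 X) (hb : Commute (rep flip').1 X) :
    (X = conf ∨ X = -conf) ∨ X = confAt swapDihedralThree ∨ X = -confAt swapDihedralThree := by
  have ea := apply_eq_of_commute actsBy_threeCycle ha
  have eb := apply_eq_of_commute actsBy_flip' hb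
  have ha' : X 0 1 = 1 * X 4 3 ∧ X 0 2 = -1 * X 4 0 ∧ X 0 3 = -1 * X 4 5 ∧
      X 0 4 = -1 * X 4 2 ∧ X 0 5 = -1 * X 4 1 ∧ X 1 2 = -1 * X 3 0 ∧ X 1 3 = -1 * X 3 5 ∧
      X 1 4 = -1 * X 3 2 ∧ X 1 5 = -1 * X 3 1 ∧ X 2 5 = 1 * X 0 1 :=
    ⟨ea 0 1, ea 0 2, ea 0 3, ea 0 4, ea 0 5, ea 1 2, ea 1 3, ea 1 4, ea 1 5, ea 2 5⟩
  have hb' : X 0 3 = -1 * X 0 5 := eb 0 3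
  have hs := hX.symm_apply
  -- Four signs remain free; X² = 5 cuts the sixteen candidates down to two pairs.
  have hr : X 0 4 = -X 0 2 ∧ X 0 5 = -X 0 3 ∧ X 1 2 = -X 0 3 ∧ X 1 4 = X 0 3 ∧
      X 1 5 = -X 1 3 ∧ X 2 3 = -X 0 3 ∧ X 2 4 = X 0 2 ∧ X 2 5 = X 0 1 ∧ X 3 4 = X 0 1 ∧
      X 3 5 = -X 1 3 ∧ X 4 5 = -X 0 3 := by
    omega
  clear ea ha' hs eb hb'
  have hm := hX.eq_matrix
  simp only [hr] at hm
  have h01 := hX.offDiag 0 1 (by decide)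
  have h02 := hX.offDiag 0 2 (by decide)
  have h03 := hX.offDiag 0 3 (by decide)
  have h13 := hX.offDiag 1 3 (by decide)
  have hsq := hX.sq
  rcases h01 with h01 | h01 <;>
    rcases h02 with h02 | h02 <;>
    rcases h03 with h03 | h03 <;>
    rcases h13 with h13 | h13 <;>
  · simp only [h01, h02, h03, h13] at hm
    rw [hm] at hsq ⊢
    revert hsq
    decide +kernel

theorem liesInTwo_dihedralThree : LiesInTwo (dihedralThree.map rep) :=
  liesInTwo_map isCoatom_dihedralThree dihedralThree_eq_closure
    (commute_rep actsBy_threeCycle (by decide +kernel))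
    (commute_rep actsBy_flip' (by decide +kernel))
    (not_commute_conj actsBy_rot3 (by decide +kernel))
    fun _ hX ha hb => conf_or_of_commute_dihedralThree hX ha hb

/-! ### The conjugates of `Î` are crystallographic representations -/

/-- The real matrix of an integer matrix. -/
def toReal : Matrix (Fin 6) (Fin 6) ℤ →+* Matrix (Fin 6) (Fin 6) ℝ :=
  (Int.castRingHom ℝ).mapMatrix

theorem realAction_apply (A : B6) (w : Fin 6 → ℝ) :
    realAction A w = (toReal A.1).mulVec w := rfl

theorem realAction_mul (A B : B6) (w : Fin 6 → ℝ) :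
    realAction (A * B) w = realAction A (realAction B w) := by
  rw [realAction_apply, realAction_apply, realAction_apply, Matrix.mulVec_mulVec, ← map_mul]
  rfl

theorem realAction_one (w : Fin 6 → ℝ) : realAction 1 w = w := by
  rw [realAction_apply, show (1 : B6).1 = 1 from rfl, map_one, Matrix.one_mulVec]

theorem realAction_inv_apply (A : B6) (w : Fin 6 → ℝ) (j : Fin 6) :
    realAction A⁻¹ w j = ∑ k, (A.1 k j : ℝ) * w k := rfl

/-- The action of an element of `B₆` on `ℝ⁶` as a linear equivalence. -/
def realEquiv (A : B6) : (Fin 6 → ℝ) ≃ₗ[ℝ] (Fin 6 → ℝ) :=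
  LinearEquiv.ofLinearMap (realAction A) (realAction A⁻¹)
    (LinearMap.ext fun w => by
      rw [LinearMap.comp_apply, ← realAction_mul, mul_inv_cancel, realAction_one]; rfl)
    (LinearMap.ext fun w => by
      rw [LinearMap.comp_apply, ← realAction_mul, inv_mul_cancel, realAction_one]; rfl)

theorem trace_realAction (A : B6) :
    LinearMap.trace ℝ (Fin 6 → ℝ) (realAction A) = (A.1.trace : ℤ) := by
  rw [realAction, Matrix.trace_toLin'_eq]
  simp [Matrix.trace]

/-- The matrix that is, up to a scalar, the projection to an eigenspace of the conference matrix. -/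
noncomputable def eigenMatrix : Matrix (Fin 6) (Fin 6) ℝ := toReal conf + √5 • 1

/-- An eigenspace of the conference matrix. -/
noncomputable def eigenSpace : Submodule ℝ (Fin 6 → ℝ) :=
  Module.End.eigenspace (Matrix.toLin' (toReal conf)) √5

theorem mem_eigenSpace {w : Fin 6 → ℝ} :
    w ∈ eigenSpace ↔ (toReal conf).mulVec w = √5 • w :=
  Module.End.mem_eigenspace_iff

theorem sq_sqrt_five : √5 * √5 = 5 := Real.mul_self_sqrt (by norm_num)

theorem toReal_conf_sq : toReal conf * toReal conf = (5 : ℝ) • 1 := by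
  have h : conf * conf = (5 : ℤ) • 1 := by decide +kernel
  rw [← map_mul, h, map_zsmul, map_one]
  ext i j
  simp

theorem eigenMatrix_mulVec_mem (w : Fin 6 → ℝ) : eigenMatrix.mulVec w ∈ eigenSpace := by
  rw [mem_eigenSpace, Matrix.mulVec_mulVec, ← Matrix.smul_mulVec, eigenMatrix]
  congr 1
  rw [mul_add, toReal_conf_sq, smul_add, smul_smul, sq_sqrt_five, Matrix.mul_smul, mul_one,
    add_comm]

theorem eigenMatrix_mulVec {w : Fin 6 → ℝ} (hw : w ∈ eigenSpace) :
    eigenMatrix.mulVec w = (2 * √5) • w := by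
  rw [eigenMatrix, Matrix.add_mulVec, mem_eigenSpace.1 hw, Matrix.smul_mulVec, Matrix.one_mulVec,
    two_mul, add_smul]

theorem inv_smul_eigenMatrix_mulVec {w : Fin 6 → ℝ} (hw : w ∈ eigenSpace) :
    (2 * √5)⁻¹ • eigenMatrix.mulVec w = w := by
  rw [eigenMatrix_mulVec hw, smul_smul, inv_mul_cancel₀ (by positivity), one_smul]

/-- The rank is the trace of the projection (C + √5)/(2√5), namely 6/2, because C has trace zero. -/
theorem finrank_eigenSpace : Module.finrank ℝ eigenSpace = 3 := by
  have hproj : LinearMap.IsProj eigenSpace (Matrix.toLin' ((2 * √5)⁻¹ • eigenMatrix)) := by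
    constructor
    · intro w
      rw [Matrix.toLin'_apply, Matrix.smul_mulVec]
      exact Submodule.smul_mem _ _ (eigenMatrix_mulVec_mem w)
    · intro w hw
      rw [Matrix.toLin'_apply, Matrix.smul_mulVec, inv_smul_eigenMatrix_mulVec hw]
  have h1 := hproj.trace
  have h2 : (toReal conf).trace = 0 := by
    have h0 : conf.trace = 0 := by decide +kernel
    have : (toReal conf).trace = ((conf.trace : ℤ) : ℝ) := by simp [Matrix.trace, toReal]
    rw [this, h0, Int.cast_zero]
  rw [Matrix.trace_toLin'_eq, Matrix.trace_smul, eigenMatrix, Matrix.trace_add, h2,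
    Matrix.trace_smul, Matrix.trace_one, Fintype.card_fin] at h1
  have h3 : (Module.finrank ℝ eigenSpace : ℝ) = 3 := by
    rw [← h1]
    have : √5 ≠ 0 := by positivity
    simp only [smul_eq_mul]
    field_simp
    push_cast
    ring
  exact_mod_cast h3

theorem isInvariant_eigenSpace : IsInvariant icoHat eigenSpace := by
  intro A hA w hw
  have h := congrArg toReal (commute_conf hA).eq
  rw [map_mul, map_mul] at h
  rw [mem_eigenSpace] at hw ⊢
  rw [realAction_apply, Matrix.mulVec_mulVec, ← h, ← Matrix.mulVec_mulVec, hw,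
    Matrix.mulVec_smul]

theorem realAction_eigenMatrix_mulVec {A : B6} (hA : A ∈ icoHat) (w : Fin 6 → ℝ) :
    realAction A (eigenMatrix.mulVec w) = eigenMatrix.mulVec (realAction A w) := by
  have h := congrArg toReal (commute_conf hA).eq
  rw [map_mul, map_mul] at h
  rw [realAction_apply, realAction_apply, Matrix.mulVec_mulVec, Matrix.mulVec_mulVec, eigenMatrix,
    mul_add, add_mul, h, Matrix.mul_smul, Matrix.smul_mul, one_mul, mul_one]

/-- The sum over the rotations about the sixth vertex. -/
theorem sum_rotations :
    ∑ k ∈ Finset.range 5, (rep fiveCycle).1 ^ k =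
      !![1, 1, 1, 1, 1, 0;
         1, 1, 1, 1, 1, 0;
         1, 1, 1, 1, 1, 0;
         1, 1, 1, 1, 1, 0;
         1, 1, 1, 1, 1, 0;
         0, 0, 0, 0, 0, 5] := by
  rw [rep_apply actsBy_fiveCycle]
  decide +kernel

theorem rep_mem_icoHat (σ : A5) : rep σ ∈ icoHat := rep_range ▸ ⟨σ, rfl⟩

theorem exists_icoHat_column (i : Fin 6) : ∃ A ∈ icoHat, ∀ k, A.1 k 5 = if i = k then 1 else 0 := by
  obtain ⟨g, hg, h5⟩ := exists_ico_apply_eq (pos i)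
  refine ⟨icoRep ⟨g, hg⟩, ⟨_, rfl⟩, fun k => ?_⟩
  rw [← coeff_pos, ← h5]
  rfl

/-- An invariant subspace of the eigenspace contains the axial vector of the sixth vertex as soon
as it has an element with nonzero last coordinate. -/
theorem axial_mem {U : Submodule ℝ (Fin 6 → ℝ)} (hU : IsInvariant icoHat U) {u : Fin 6 → ℝ}
    (hu : u ∈ U) (hu' : u ∈ eigenSpace) (h5 : u 5 ≠ 0) :
    eigenMatrix.mulVec (Pi.single 5 1) ∈ U := by
  have hsum : (toReal (∑ k ∈ Finset.range 5, (rep fiveCycle).1 ^ k)).mulVec u ∈ U := by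
    rw [map_sum, Matrix.sum_mulVec]
    refine Submodule.sum_mem _ fun k _ => ?_
    exact hU _ (pow_mem (rep_mem_icoHat fiveCycle) k) u hu
  -- The last coordinate of the eigenvector equation expresses the rotation sum of `u` through `u 5`
  -- alone.
  have hrow : u 0 + u 1 + u 2 + u 3 + u 4 = √5 * u 5 := by
    have h := congrFun (mem_eigenSpace.1 hu') 5
    simpa [Matrix.mulVec, dotProduct, Fin.sum_univ_six, toReal, conf] using h
  have heq : (toReal (∑ k ∈ Finset.range 5, (rep fiveCycle).1 ^ k)).mulVec u =
      (√5 * u 5) • eigenMatrix.mulVec (Pi.single 5 1) := by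
    rw [sum_rotations]
    ext i
    fin_cases i <;>
      simp [Matrix.mulVec, dotProduct, Fin.sum_univ_six, toReal, eigenMatrix, conf, hrow]
    linear_combination (-u 5) * sq_sqrt_five
  rw [heq] at hsum
  have hne : √5 * u 5 ≠ 0 := mul_ne_zero (by positivity) h5
  exact (Submodule.smul_mem_iff _ hne).1 hsum

/-- A nonzero coordinate can be rotated to the last place, so `axial_mem` yields one axial vector.
Transitivity on the axes yields the others, and these span the eigenspace. -/
theorem eq_bot_or_eq_eigenSpace {U : Submodule ℝ (Fin 6 → ℝ)} (hle : U ≤ eigenSpace)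
    (hU : IsInvariant icoHat U) : U = ⊥ ∨ U = eigenSpace := by
  refine or_iff_not_imp_left.2 fun hne => le_antisymm hle fun w hw => ?_
  obtain ⟨u, hu, hu0⟩ := Submodule.exists_mem_ne_zero_of_ne_bot hne
  obtain ⟨i, hi⟩ := Function.ne_iff.1 hu0
  have h5 : eigenMatrix.mulVec (Pi.single 5 1) ∈ U := by
    obtain ⟨A, hA, hcol⟩ := exists_icoHat_column i
    have hmem := hU _ (inv_mem hA) u hu
    refine axial_mem hU hmem (hle hmem) ?_
    rw [realAction_inv_apply]
    simpa [hcol] using hi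
  have hall : ∀ i, eigenMatrix.mulVec (Pi.single i 1) ∈ U := by
    intro i
    obtain ⟨A, hA, hcol⟩ := exists_icoHat_column i
    have hmem := hU _ hA _ h5
    rw [realAction_eigenMatrix_mulVec hA] at hmem
    convert hmem using 2
    rw [realAction_apply, Matrix.mulVec_single_one]
    ext k
    simp [toReal, hcol, Pi.single_apply, eq_comm]
  rw [← inv_smul_eigenMatrix_mulVec hw]
  refine Submodule.smul_mem _ _ ?_
  rw [← Matrix.toLin'_apply, pi_eq_sum_univ' w, map_sum]
  refine Submodule.sum_mem _ fun i _ => ?_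
  rw [map_smul, Matrix.toLin'_apply]
  refine Submodule.smul_mem _ _ ?_
  convert hall i using 2

theorem isCrystallographic_of_mem {H : Subgroup B6} (hH : H ∈ crystReps) :
    IsCrystallographic H := by
  obtain ⟨g, rfl⟩ := hH
  change IsCrystallographic (MulAut.conj g • icoHat)
  have hmem : ∀ A ∈ icoHat, g * A * g⁻¹ ∈ MulAut.conj g • icoHat := fun A hA =>
    Subgroup.smul_mem_pointwise_smul _ (MulAut.conj g) _ hA
  refine ⟨⟨(Subgroup.equivSMul (MulAut.conj g) icoHat).symm.trans
    (MonoidHom.ofInjective icoRep_injective).symm⟩, fun A _ => ⟨_, trace_realAction A⟩,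
    eigenSpace.map (realEquiv g).toLinearMap, .inr ?_, ?_, ?_⟩
  · rw [LinearEquiv.finrank_map_eq, finrank_eigenSpace]
  · rintro _ ⟨A, hA, rfl⟩ _ ⟨w, hw, rfl⟩
    refine ⟨_, isInvariant_eigenSpace A hA w hw, ?_⟩
    change realAction g (realAction A w) = realAction (g * A * g⁻¹) (realAction g w)
    rw [← realAction_mul, ← realAction_mul, inv_mul_cancel_right]
  · intro U hle hU
    have hinv : IsInvariant icoHat (U.comap (realEquiv g).toLinearMap) := by
      intro A hA w hw
      have h := hU _ (hmem A hA) _ hw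
      change realAction (g * A * g⁻¹) (realAction g w) ∈ U at h
      rw [← realAction_mul, inv_mul_cancel_right, realAction_mul] at h
      exact h
    have hle' : U.comap (realEquiv g).toLinearMap ≤ eigenSpace := by
      rw [← Submodule.comap_map_eq_of_injective (realEquiv g).injective eigenSpace]
      exact Submodule.comap_mono hle
    rw [← Submodule.map_comap_eq_of_surjective (realEquiv g).surjective U]
    rcases eq_bot_or_eq_eigenSpace hle' hinv with h | h
    · exact .inl (by rw [h, Submodule.map_bot])
    · exact .inr (by rw [h])

/-! ### The intersection property -/

theorem liesInTwo_of_isCoatom {F : Subgroup A5} (hF : IsCoatom F) : LiesInTwo (F.map rep) := by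
  obtain ⟨σ, F, h, rfl⟩ := exists_conj_eq_of_isCoatom hF
  rw [smul_map]
  apply LiesInTwo.conj_smul
  rcases h with rfl | rfl | rfl
  exacts [liesInTwo_tetra, liesInTwo_dihedralFive, liesInTwo_dihedralThree]

theorem liesInTwo_of_mem_conjClass {G : Subgroup ico} (hG : IsCoatom G) {P : Subgroup B6}
    (hP : P ∈ conjClass (copy G)) : LiesInTwo P := by
  obtain ⟨g, rfl⟩ := hP
  rw [copy_eq]
  exact (liesInTwo_of_isCoatom ((isCoatom_map_iff G).2 hG)).conj_smul g

/-- Conjugating `H` back to Î turns `P` into the image of a maximal subgroup of A₅. -/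
theorem liesInTwo_of_covBy {H P : Subgroup B6} (hH : H ∈ crystReps) (hP : P ⋖ H) :
    LiesInTwo P := by
  obtain ⟨g, rfl⟩ := hH
  have hP' : MulAut.conj g⁻¹ • P ⋖ icoHat := by
    have h := (apply_covBy_apply_iff (MulAut.conj g⁻¹).mapSubgroup).2 hP
    change MulAut.conj g⁻¹ • P ⋖ MulAut.conj g⁻¹ • MulAut.conj g • icoHat at h
    rwa [map_inv, inv_smul_smul] at h
  have hF : ((MulAut.conj g⁻¹ • P).comap rep).map rep = MulAut.conj g⁻¹ • P :=
    Subgroup.map_comap_eq_self (hP'.le.trans rep_range.ge)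
  rw [← hF, map_rep_covBy_iff] at hP'
  have h := (liesInTwo_of_isCoatom hP').conj_smul g
  rwa [hF, map_inv, smul_inv_smul] at h

end Icosahedral

theorem mainTheorem3 :
    -- the maximal subgroups of the icosahedral group are exactly its copies of `T`, `D₁₀`, `D₆`
    (∀ G : Subgroup Icosahedral.ico,
      IsCoatom G ↔
        Nonempty (G ≃* alternatingGroup (Fin 4)) ∨
        Nonempty (G ≃* DihedralGroup 5) ∨
        Nonempty (G ≃* DihedralGroup 3)) ∧
    -- the members of the class of `Î` are crystallographic representations
    (∀ H ∈ Icosahedral.crystReps, Icosahedral.IsCrystallographic H) ∧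
    -- each conjugate of `K_G` is the intersection of exactly two of these representations
    (∀ G : Subgroup Icosahedral.ico, IsCoatom G →
      ∀ P ∈ Icosahedral.conjClass (Icosahedral.copy G),
        ∃ H₁ ∈ Icosahedral.crystReps, ∃ H₂ ∈ Icosahedral.crystReps,
          H₁ ≠ H₂ ∧ P = H₁ ⊓ H₂ ∧
          ∀ K₁ ∈ Icosahedral.crystReps, ∀ K₂ ∈ Icosahedral.crystReps, P = K₁ ⊓ K₂ →
            (K₁ = H₁ ∧ K₂ = H₂) ∨ (K₁ = H₂ ∧ K₂ = H₁)) ∧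
    -- each maximal subgroup `P` of `H` joins `H` to exactly one other representation
    (∀ H ∈ Icosahedral.crystReps, ∀ P : Subgroup Icosahedral.B6, P ⋖ H →
      ∃! K : Subgroup Icosahedral.B6,
        K ∈ Icosahedral.crystReps ∧ K ≠ H ∧ P = H ⊓ K) := by
  open Icosahedral in
  refine ⟨ico_isCoatom_iff, fun H hH => isCrystallographic_of_mem hH, fun G hG P hP => ?_,
    fun H hH P hP => ?_⟩
  · obtain ⟨H₁, h₁, H₂, h₂, hne, hcov, hiff⟩ := liesInTwo_of_mem_conjClass hG hP
    have hP2 := (hiff H₂ h₂).2 (.inr rfl)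
    have hPH₁ : P ≠ H₁ := hcov.ne
    have hPH₂ : P ≠ H₂ := by
      rintro rfl
      exact hPH₁ (eq_of_le_of_mem_crystReps h₂ h₁ hcov.le)
    refine ⟨H₁, h₁, H₂, h₂, hne, eq_inf_of_covBy h₁ h₂ hcov hP2 hne.symm,
      fun K₁ hK₁ K₂ hK₂ hPK => ?_⟩
    have hle : P ≤ K₁ ⊓ K₂ := hPK.le
    -- Equal members would make `P` itself one of the two conjugates, which its maximality in `H₁`
    -- and equality of orders forbid.
    rcases (hiff K₁ hK₁).1 (hle.trans inf_le_left) with rfl | rfl <;>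
      rcases (hiff K₂ hK₂).1 (hle.trans inf_le_right) with rfl | rfl
    · exact absurd (hPK.trans (inf_idem _)) hPH₁
    · exact .inl ⟨rfl, rfl⟩
    · exact .inr ⟨rfl, rfl⟩
    · exact absurd (hPK.trans (inf_idem _)) hPH₂
  · obtain ⟨H₁, h₁, H₂, h₂, hne, -, hiff⟩ := liesInTwo_of_covBy hH hP
    have key : ∀ K ∈ crystReps, K ≠ H → (∀ L ∈ crystReps, P ≤ L ↔ L = H ∨ L = K) →
        ∃! K, K ∈ crystReps ∧ K ≠ H ∧ P = H ⊓ K := by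
      intro K hK hKH h
      refine ⟨K, ⟨hK, hKH, eq_inf_of_covBy hH hK hP ((h K hK).2 (.inr rfl)) hKH⟩, ?_⟩
      rintro L ⟨hL, hLH, hPL⟩
      exact ((h L hL).1 (hPL.le.trans inf_le_right)).resolve_left hLH
    rcases (hiff H hH).1 hP.le with rfl | rfl
    · exact key H₂ h₂ hne.symm hiff
    · exact key H₁ h₁ hne fun L hL => (hiff L hL).trans or_comm
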